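/- Let $E/\mathbb{Q}$ and $E'/\mathbb{Q}$ be elliptic curves and let $\ell$ be a prime number. Suppose there is an isogeny $\phi\colon E\to E'$ defined over $\mathbb{Q}$ (a non-constant morphism of curves over $\mathbb{Q}$ mapping the identity of $E$ to the identity of $E'$) whose kernel in $E(\overline{\mathbb{Q}})$ is finite and cyclic, of order not divisible by $\ell$. Let $G_{\mathbb{Q}}=\operatorname{Gal}(\overline{\mathbb{Q}}/\mathbb{Q})$, and let $\rho_{E,\ell^{\infty}}\colon G_{\mathbb{Q}}\to\operatorname{Aut}_{\mathbb{Z}_\ell}(T_\ell(E))$ and $\rho_{E',\ell^{\infty}}\colon G_{\mathbb{Q}}\to\operatorname{Aut}_{\mathbb{Z}_\ell}(T_\ell(E'))$ be the $\ell$-adic Galois representations on the Tate modules $T_\ell(E)=\varprojlim_n E[\ell^n]$ and $T_\ell(E')=\varprojlim_n E'[\ell^n]$. Then the images of these two representations are conjugate: there is a $\mathbb{Z}_\ell$-linear isomorphism $f\colon T_\ell(E)\to T_\ell(E')$ with $$\rho_{E',\ell^{\infty}}(G_{\mathbb{Q}})=f\,\rho_{E,\ell^{\infty}}(G_{\mathbb{Q}})\,f^{-1},$$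 and, for every choice of $\mathbb{Z}_\ell$-bases of $T_\ell(E)$ and $T_\ell(E')$, the corresponding images of $G_{\mathbb{Q}}$ in $\operatorname{GL}(2,\mathbb{Z}_\ell)$ are conjugate subgroups of $\operatorname{GL}(2,\mathbb{Z}_\ell)$. -/

import Mathlib

noncomputable section

/-! ### The `p`-adic Tate module of an abelian group -/

/-- The `p`-adic Tate module of an additive abelian group `A`, that is the inverse limit of the
groups `A[p ^ n]` along multiplication by `p`: sequences `(x₀, x₁, x₂, …)` with `x₀ = 0` and
`p • xₙ₊₁ = xₙ`, so that `xₙ ∈ A[p ^ n]`. -/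
def TateModule (A : Type*) [AddCommGroup A] (p : ℕ) : AddSubgroup (ℕ → A) where
  carrier := {x | x 0 = 0 ∧ ∀ n, p • x (n + 1) = x n}
  zero_mem' := by simp
  add_mem' := by
    rintro x y ⟨hx, hx'⟩ ⟨hy, hy'⟩
    exact ⟨by simp [hx, hy], fun n => by simp [hx', hy']⟩
  neg_mem' := by
    rintro x ⟨hx, hx'⟩
    exact ⟨by simp [hx], fun n => by simp [hx']⟩

namespace TateModule

variable {A B : Type*} [AddCommGroup A] [AddCommGroup B] {p : ℕ}

theorem pow_smul_apply (x : TateModule A p) (n : ℕ) : p ^ n • x.1 n = 0 := by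
  induction n with
  | zero => simpa using x.2.1
  | succ n ih => rw [pow_succ, mul_smul, x.2.2 n, ih]

/-- Two natural numbers that are congruent modulo `p ^ n` act in the same way on the `n`-th
component of the Tate module. -/
theorem smul_congr (x : TateModule A p) (n : ℕ) {a b : ℕ}
    (h : (a : ZMod (p ^ n)) = (b : ZMod (p ^ n))) : a • x.1 n = b • x.1 n := by
  have h' := (ZMod.natCast_eq_natCast_iff _ _ _).1 h
  exact nsmul_eq_nsmul_iff_modEq.2
    (h'.of_dvd (addOrderOf_dvd_of_nsmul_eq_zero (pow_smul_apply x n)))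

variable [Fact p.Prime]

/-- `a ∈ ℤ_[p]` acts on the `n`-th component through its residue class modulo `p ^ n`. -/
instance : SMul ℤ_[p] (TateModule A p) where
  smul a x := ⟨fun n => (PadicInt.toZModPow n a).val • x.1 n, by
    refine ⟨by simp [x.2.1], fun n => ?_⟩
    rw [smul_comm, x.2.2 n]
    apply smul_congr
    have := PadicInt.cast_toZModPow n (n + 1) n.le_succ a
    rw [ZMod.natCast_val, ZMod.natCast_val, this, ZMod.cast_id]⟩

theorem smul_apply (a : ℤ_[p]) (x : TateModule A p) (n : ℕ) :
    (a • x).1 n = (PadicInt.toZModPow n a).val • x.1 n := rfl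

instance : Module ℤ_[p] (TateModule A p) where
  one_smul x := by
    ext n
    rw [smul_apply]
    conv_rhs => rw [← one_smul ℕ (x.1 n)]
    apply smul_congr
    simp
  mul_smul a b x := by
    ext n
    rw [smul_apply, smul_apply, smul_apply, ← mul_smul]
    apply smul_congr
    simp
  smul_zero a := by
    ext n
    simp [smul_apply]
  smul_add a x y := by
    ext n
    simp [smul_apply]
  add_smul a b x := by
    ext n
    rw [smul_apply, AddSubgroup.coe_add, Pi.add_apply, smul_apply, smul_apply, ← add_smul]
    apply smul_congr
    simp
  zero_smul x := by
    ext n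
    simp [smul_apply]

/-- The `ℤ_[p]`-linear map of Tate modules induced by a homomorphism of abelian groups. -/
def map (f : A →+ B) : TateModule A p →ₗ[ℤ_[p]] TateModule B p where
  toFun x := ⟨fun n => f (x.1 n), by
    refine ⟨by simp [x.2.1], fun n => ?_⟩
    rw [← map_nsmul, x.2.2 n]⟩
  map_add' x y := by
    ext n
    simp
  map_smul' a x := by
    ext n
    simp [smul_apply]

end TateModule

/-! ### Elliptic curves over `ℚ`: geometric points, isogenies, Galois representations -/

namespace WeierstrassCurve

local notation "ℚbar" => AlgebraicClosure ℚ

instance : DecidableEq ℚbar := Classical.decEq _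

/-- The group `E(ℚbar)` of geometric points of an elliptic curve over `ℚ`. -/
abbrev GeomPoint (E : WeierstrassCurve ℚ) : Type :=
  (E.baseChange ℚbar).toAffine.Point

variable (E E' : WeierstrassCurve ℚ)

/-- Homogeneous coordinates of a geometric point in the projective plane: `[0 : 1 : 0]` for the
identity `O` and `[x : y : 1]` for an affine point `(x, y)`. -/
def homCoords : E.GeomPoint → Fin 3 → ℚbar
  | .zero => ![0, 1, 0]
  | .some x y _ => ![x, y, 1]

variable {E E'} in
/-- A map on geometric points is a morphism of projective curves defined over `ℚ` if around every
geometric point it is given by a triple of homogeneous polynomials of the same degree with rational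
coefficients. The triple `F` describes `φ` on the open set where its members do not all vanish. -/
def IsRationalMorphism (φ : E.GeomPoint → E'.GeomPoint) : Prop :=
  ∀ P : E.GeomPoint, ∃ (d : ℕ) (F : Fin 3 → MvPolynomial (Fin 3) ℚ),
    (∀ i, (F i).IsHomogeneous d) ∧
    (∃ i, MvPolynomial.aeval (E.homCoords P) (F i) ≠ 0) ∧
    ∀ Q : E.GeomPoint, (∃ i, MvPolynomial.aeval (E.homCoords Q) (F i) ≠ 0) →
      ∃ c : ℚbar, c ≠ 0 ∧
        ∀ i, MvPolynomial.aeval (E.homCoords Q) (F i) = c * E'.homCoords (φ Q) i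

variable {E E'} in
/-- A `ℚ`-isogeny `E → E'`: a non-constant morphism of curves defined over `ℚ` that maps the
identity of `E` to the identity of `E'`. -/
structure IsRationalIsogeny (φ : E.GeomPoint → E'.GeomPoint) : Prop where
  isRationalMorphism : IsRationalMorphism φ
  map_zero : φ 0 = 0
  nonconstant : ∃ P Q, φ P ≠ φ Q

variable {E E'} in
/-- The kernel of an isogeny, as a set of geometric points. -/
def isogenyKer (φ : E.GeomPoint → E'.GeomPoint) : Set E.GeomPoint :=
  {P | φ P = 0}

/-- The action of `σ ∈ Gal(ℚbar/ℚ)` on the coordinates of the geometric points of `E`. -/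
def galoisMap (σ : ℚbar ≃ₐ[ℚ] ℚbar) : E.GeomPoint →+ E.GeomPoint :=
  Affine.Point.map (W' := E) σ.toAlgHom

/-- The `ℓ`-adic Tate module `T_ℓ(E)`. -/
abbrev tateModule (ℓ : ℕ) : Type :=
  TateModule E.GeomPoint ℓ

/-- The `ℓ`-adic Galois representation `ρ_{E,ℓ^∞} : Gal(ℚbar/ℚ) → Aut(T_ℓ(E))`. -/
def galoisRep (ℓ : ℕ) [Fact ℓ.Prime] :
    (ℚbar ≃ₐ[ℚ] ℚbar) →* LinearMap.GeneralLinearGroup ℤ_[ℓ] (E.tateModule ℓ) :=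
  MonoidHom.toHomUnits
    { toFun := fun σ => TateModule.map (E.galoisMap σ)
      map_one' := by
        ext x n
        exact Affine.Point.map_id (W' := E) (x.1 n)
      map_mul' := fun σ τ => by
        ext x n
        exact (Affine.Point.map_map (W' := E) τ.toAlgHom σ.toAlgHom (x.1 n)).symm }

/-- The image of the `ℓ`-adic Galois representation of `E` in `Aut(T_ℓ(E))`. -/
def adicImage (ℓ : ℕ) [Fact ℓ.Prime] :
    Subgroup (LinearMap.GeneralLinearGroup ℤ_[ℓ] (E.tateModule ℓ)) :=
  (E.galoisRep ℓ).range

variable {E} in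
/-- The image of the `ℓ`-adic Galois representation of `E` as a subgroup of `GL(2, ℤ_ℓ)`, with
respect to a basis of `T_ℓ(E)` over `ℤ_ℓ`. The columns of the matrix of `σ` are the coordinates of
the images of the basis vectors. -/
def adicImageMatrix {ℓ : ℕ} [Fact ℓ.Prime] (b : Module.Basis (Fin 2) ℤ_[ℓ] (E.tateModule ℓ)) :
    Subgroup (GL (Fin 2) ℤ_[ℓ]) :=
  (E.adicImage ℓ).map (Units.map (LinearMap.toMatrixAlgEquiv b : _ →* _))

end WeierstrassCurve

end

/-! Once `φ` is known to be a surjective, Galois-equivariant group homomorphism, the theorem is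
formal. A kernel of order prime to `ℓ` neither contains nontrivial `ℓ`-power torsion nor obstructs
lifting it, so `φ` induces an isomorphism of Tate modules (`TateModule.map_bijective`), and this
isomorphism intertwines the two representations. Equivariance holds because the polynomials
describing `φ` have rational coefficients. The bulk of the proof shows that a nonconstant morphism
preserving the identity is additive and surjective.

Additivity comes from the invariant differential. Let `L` be the function field of `E`, let `D` be
the derivation of `L` dual to the invariant differential of `E`, and let `Φ` be the point of `E'`
over `L` that is the value of `φ` at the generic point. The pullback along `Φ` of the differential
of `E'`, evaluated at `D`, is a function `d` on `E`. It is additive in the point (`IsLogDeriv.add`)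
and regular everywhere, hence constant (`IsGenericValue.exists_isLogDeriv`). A translation `τ` of
`E` commutes with `D`, so `τ Φ` and `Φ` have the same `d`. Their difference then has coordinates
killed by `D`, so it is a constant point `R` (`IsGenericValue.exists_map_translation`). Specializing
`τ Φ = Φ + R` at the identity gives `R = φ Q` when `τ` is translation by `Q`
(`IsGenericValue.eq_of_map_translation`). Composing two translations gives additivity.

For surjectivity, if a point with first coordinate `a` were missed, its negative would be missed
too, and `1 / (x(Φ) - a)` would be a nonconstant function regular everywhere. -/

namespace WeierstrassCurve.Affine

/-! ### The logarithmic derivative of a point with respect to the invariant differential -/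

section LogDeriv

variable {A L : Type*} [CommRing A] [Field L] [Algebra A L] (D : Derivation A L L) (W : Affine L)

/-- The coefficients of `W` are constants of the derivation `D`. -/
structure IsHorizontal : Prop where
  a₁ : D W.a₁ = 0
  a₂ : D W.a₂ = 0
  a₃ : D W.a₃ = 0
  a₄ : D W.a₄ = 0
  a₆ : D W.a₆ = 0

variable {W} in
/-- `d` is the value at `D` of the pullback of the invariant differential `dx / (2y + a₁x + a₃)`
along the point `P`. -/
def Point.IsLogDeriv : W.Point → L → Prop
  | .zero, d => d = 0
  | .some x y _, d => D x = d * (2 * y + W.a₁ * x + W.a₃) ∧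
      D y = d * (3 * x ^ 2 + 2 * W.a₂ * x + W.a₄ - W.a₁ * y)

variable {D W}

namespace Point

lemma isLogDeriv_zero_iff {d : L} : IsLogDeriv D (0 : W.Point) d ↔ d = 0 := Iff.rfl

lemma isLogDeriv_some_iff {x y : L} (h : W.Nonsingular x y) {d : L} :
    IsLogDeriv D (.some x y h) d ↔ D x = d * (2 * y + W.a₁ * x + W.a₃) ∧
      D y = d * (3 * x ^ 2 + 2 * W.a₂ * x + W.a₄ - W.a₁ * y) := Iff.rfl

lemma partial_ne_zero {x y : L} (h : W.Nonsingular x y) :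
    2 * y + W.a₁ * x + W.a₃ ≠ 0 ∨ 3 * x ^ 2 + 2 * W.a₂ * x + W.a₄ - W.a₁ * y ≠ 0 := by
  have := ((W.nonsingular_iff' x y).1 h).2
  rcases this with h | h
  · exact .inr fun h' => h (by linear_combination -h')
  · exact .inl h

/-- Differentiating the Weierstrass equation shows that the two conditions in `IsLogDeriv` are
compatible. -/
lemma derivation_equation (hD : W.IsHorizontal D) {x y : L} (h : W.Equation x y) :
    (2 * y + W.a₁ * x + W.a₃) * D y = (3 * x ^ 2 + 2 * W.a₂ * x + W.a₄ - W.a₁ * y) * D x := by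
  have h' := congrArg D ((W.equation_iff x y).1 h)
  simp only [map_add, Derivation.leibniz, Derivation.leibniz_pow, hD.a₁, hD.a₂, hD.a₃, hD.a₄,
    hD.a₆, smul_eq_mul, nsmul_eq_mul] at h'
  push_cast at h'
  linear_combination h'

lemma exists_isLogDeriv [CharZero L] (hD : W.IsHorizontal D) (P : W.Point) :
    ∃ d, IsLogDeriv D P d := by
  rcases P with _ | ⟨x, y, h⟩
  · exact ⟨0, rfl⟩
  have e := derivation_equation hD h.1
  by_cases hu : 2 * y + W.a₁ * x + W.a₃ = 0
  -- This is the 2-torsion case. The other partial derivative is nonzero, so `D x = 0`;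
  -- differentiating `hu` then gives `2 * D y = 0`.
  · have hv := (partial_ne_zero h).resolve_left (not_not.2 hu)
    have hx : D x = 0 := by
      rw [hu, zero_mul, eq_comm, mul_eq_zero] at e
      exact e.resolve_left hv
    have hu' := congrArg D hu
    have h2 : D (2 : L) = 0 := by exact_mod_cast D.map_natCast 2
    simp only [map_add, Derivation.leibniz, hD.a₁, hD.a₃, h2, hx, smul_eq_mul] at hu'
    have hy : D y = 0 := by
      have : (2 : L) * D y = 0 := by rw [D.map_zero] at hu'; linear_combination hu'
      simpa using this
    exact ⟨0, by simp [isLogDeriv_some_iff, hx, hy]⟩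
  · refine ⟨D x / (2 * y + W.a₁ * x + W.a₃), ?_, ?_⟩
    · field_simp
    · field_simp
      linear_combination e

lemma IsLogDeriv.unique {P : W.Point} {d e : L} (hd : IsLogDeriv D P d) (he : IsLogDeriv D P e) :
    d = e := by
  rcases P with _ | ⟨x, y, h⟩
  · exact hd.trans he.symm
  · rcases partial_ne_zero h with h' | h'
    · exact mul_right_cancel₀ h' (hd.1.symm.trans he.1)
    · exact mul_right_cancel₀ h' (hd.2.symm.trans he.2)

lemma IsLogDeriv.neg (hD : W.IsHorizontal D) {P : W.Point} {d : L} (hd : IsLogDeriv D P d) :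
    IsLogDeriv D (-P) (-d) := by
  rcases P with _ | ⟨x, y, h⟩
  · exact neg_eq_zero.2 hd
  · rw [neg_some, isLogDeriv_some_iff]
    rw [isLogDeriv_some_iff] at hd
    refine ⟨?_, ?_⟩
    · rw [hd.1, negY]; ring
    · simp only [negY, map_sub, map_neg, Derivation.leibniz, hD.a₁, hD.a₃, smul_eq_mul, hd.1, hd.2]
      ring

/-- This treats chord and tangent at once. `hc` is the difference of the two curve equations divided
by `x₁ - x₂`, a form that survives the limit `x₁ = x₂`, where it becomes the tangent slope formula.
`hDl` is the only other information needed about the slope. -/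
lemma isLogDeriv_add_aux (hD : W.IsHorizontal D) {x₁ x₂ y₁ y₂ l d₁ d₂ : L}
    (hx₁ : D x₁ = d₁ * (2 * y₁ + W.a₁ * x₁ + W.a₃))
    (hy₁ : D y₁ = d₁ * (3 * x₁ ^ 2 + 2 * W.a₂ * x₁ + W.a₄ - W.a₁ * y₁))
    (hx₂ : D x₂ = d₂ * (2 * y₂ + W.a₁ * x₂ + W.a₃))
    (hl : l * (x₁ - x₂) = y₁ - y₂)
    (hc : l * (y₁ + y₂) + W.a₁ * (y₁ + x₂ * l) + W.a₃ * l =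
      x₁ ^ 2 + x₁ * x₂ + x₂ ^ 2 + W.a₂ * (x₁ + x₂) + W.a₄)
    (hDl : D l = d₁ * (x₁ - W.addX x₁ x₂ l) + d₂ * (x₂ - W.addX x₁ x₂ l)) :
    D (W.addX x₁ x₂ l) = (d₁ + d₂) * (2 * W.addY x₁ x₂ y₁ l + W.a₁ * W.addX x₁ x₂ l + W.a₃) ∧
    D (W.addY x₁ x₂ y₁ l) = (d₁ + d₂) * (3 * W.addX x₁ x₂ l ^ 2 + 2 * W.a₂ * W.addX x₁ x₂ l +
      W.a₄ - W.a₁ * W.addY x₁ x₂ y₁ l) := by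
  have hX : D (W.addX x₁ x₂ l) =
      (d₁ + d₂) * (2 * W.addY x₁ x₂ y₁ l + W.a₁ * W.addX x₁ x₂ l + W.a₃) := by
    have : D (W.addX x₁ x₂ l) = (2 * l + W.a₁) * D l - D x₁ - D x₂ := by
      simp only [addX, map_add, map_sub, Derivation.leibniz, Derivation.leibniz_pow, hD.a₁, hD.a₂,
        smul_eq_mul, nsmul_eq_mul]
      push_cast
      ring
    rw [this, hDl, hx₁, hx₂]
    simp only [addY, negAddY, negY]
    have h₂ : y₂ = y₁ - l * (x₁ - x₂) := by rw [hl]; ring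
    rw [h₂]
    simp only [addX]
    ring
  refine ⟨hX, ?_⟩
  have hY : D (W.addY x₁ x₂ y₁ l) = -D y₁ - D l * (W.addX x₁ x₂ l - x₁) -
      l * (D (W.addX x₁ x₂ l) - D x₁) - W.a₁ * D (W.addX x₁ x₂ l) := by
    simp only [addY, negAddY, negY, map_add, map_sub, map_neg, Derivation.leibniz, hD.a₁, hD.a₃,
      smul_eq_mul]
    ring
  rw [hY, hX, hDl, hy₁, hx₁]
  have h₂ : y₂ = y₁ - l * (x₁ - x₂) := by rw [hl]; ring
  rw [h₂] at hc
  simp only [addY, negAddY, negY]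
  simp only [addX]
  linear_combination (2 * d₁ + d₂) * hc

/-- This is the additivity of pullbacks of the invariant differential. In both the chord and the
tangent case, `D` of the slope is found by differentiating the equation that defines the slope. -/
lemma IsLogDeriv.add [CharZero L] [DecidableEq L] (hD : W.IsHorizontal D) {P Q : W.Point}
    {d e : L} (hd : IsLogDeriv D P d) (he : IsLogDeriv D Q e) : IsLogDeriv D (P + Q) (d + e) := by
  rcases P with _ | ⟨x₁, y₁, h₁⟩
  · rw [← zero_def] at hd ⊢
    rwa [isLogDeriv_zero_iff.1 hd, zero_add, zero_add]
  rcases Q with _ | ⟨x₂, y₂, h₂⟩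
  · rw [← zero_def] at he ⊢
    rwa [isLogDeriv_zero_iff.1 he, add_zero, add_zero]
  by_cases hxy : x₁ = x₂ ∧ y₁ = W.negY x₂ y₂
  · have hP : some x₁ y₁ h₁ = -some x₂ y₂ h₂ := by
      rw [neg_some, some.injEq]
      exact hxy
    rw [hP, neg_add_cancel, isLogDeriv_zero_iff]
    rw [hP] at hd
    rw [hd.unique (he.neg hD), neg_add_cancel]
  rw [add_some hxy, isLogDeriv_some_iff]
  rw [isLogDeriv_some_iff] at hd he
  have e₁ := (W.equation_iff _ _).1 h₁.1
  have e₂ := (W.equation_iff _ _).1 h₂.1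
  by_cases hx : x₁ = x₂
  · obtain rfl : y₁ = y₂ := Y_eq_of_Y_ne h₁.1 h₂.1 hx fun h => hxy ⟨hx, h⟩
    subst hx
    have hy : y₁ ≠ W.negY x₁ y₁ := fun h => hxy ⟨rfl, h⟩
    have hs := slope_of_Y_ne rfl hy
    have hu : y₁ - W.negY x₁ y₁ ≠ 0 := sub_ne_zero.2 hy
    obtain rfl : d = e := IsLogDeriv.unique (P := some x₁ y₁ h₁) hd he
    set l := W.slope x₁ x₁ y₁ y₁
    have hs' : l * (2 * y₁ + W.a₁ * x₁ + W.a₃) =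
        3 * x₁ ^ 2 + 2 * W.a₂ * x₁ + W.a₄ - W.a₁ * y₁ := by
      rw [eq_div_iff hu] at hs
      rw [← hs, negY]
      ring
    refine isLogDeriv_add_aux hD hd.1 hd.2 he.1 (by ring) (by linear_combination hs') ?_
    have h2 : D (2 : L) = 0 := by exact_mod_cast D.map_natCast 2
    have h3 : D (3 : L) = 0 := by exact_mod_cast D.map_natCast 3
    have hs'' := congrArg D hs'
    simp only [map_add, map_sub, Derivation.leibniz, Derivation.leibniz_pow, hD.a₁, hD.a₂, hD.a₃,
      hD.a₄, h2, h3, smul_eq_mul, nsmul_eq_mul, hd.1, hd.2] at hs''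
    push_cast at hs''
    refine mul_right_cancel₀ hu ?_
    simp only [addX, negY]
    linear_combination hs'' + d * (2 * l + W.a₁) * hs'
  · have hx' : x₁ - x₂ ≠ 0 := sub_ne_zero.2 hx
    have hs := W.slope_of_X_ne (y₁ := y₁) (y₂ := y₂) hx
    generalize W.slope x₁ x₂ y₁ y₂ = l at hs ⊢
    have hl : l * (x₁ - x₂) = y₁ - y₂ := by rw [hs, div_mul_cancel₀ _ hx']
    have hc : l * (y₁ + y₂) + W.a₁ * (y₁ + x₂ * l) + W.a₃ * l =
        x₁ ^ 2 + x₁ * x₂ + x₂ ^ 2 + W.a₂ * (x₁ + x₂) + W.a₄ := by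
      refine mul_right_cancel₀ hx' ?_
      linear_combination (y₁ + y₂ + W.a₁ * x₂ + W.a₃) * hl + e₁ - e₂
    refine isLogDeriv_add_aux hD hd.1 hd.2 he.1 hl hc ?_
    have hDl := congrArg D hl
    simp only [map_sub, Derivation.leibniz, smul_eq_mul, hd.1, hd.2, he.1, he.2] at hDl
    refine mul_right_cancel₀ hx' ?_
    have hy₂ : y₂ = y₁ - l * (x₁ - x₂) := by rw [hl]; ring
    rw [hy₂] at hDl hc
    simp only [addX]
    linear_combination hDl - (d - e) * hc

lemma IsLogDeriv.sub [CharZero L] [DecidableEq L] (hD : W.IsHorizontal D) {P Q : W.Point}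
    {d e : L} (hd : IsLogDeriv D P d) (he : IsLogDeriv D Q e) : IsLogDeriv D (P - Q) (d - e) := by
  rw [sub_eq_add_neg, sub_eq_add_neg]
  exact hd.add hD (he.neg hD)

end Point

end LogDeriv

end WeierstrassCurve.Affine

namespace WeierstrassCurve.Affine.CoordinateRing

open Polynomial

/-! ### Pole orders at infinity -/

section PoleOrder

variable {K : Type*} [Field K] {W : Affine K}

/-- The pole order at infinity of an element of the affine coordinate ring, with value `⊥` at
`0`. -/
noncomputable def poleOrder (f : W.CoordinateRing) : WithBot ℕ :=
  (Algebra.norm K[X] f).degree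

lemma poleOrder_smul_basis (p q : K[X]) :
    poleOrder (p • (1 : W.CoordinateRing) + q • mk W X) =
      max (2 • p.degree) (2 • q.degree + 3) :=
  degree_norm_smul_basis p q

lemma poleOrder_zero : poleOrder (0 : W.CoordinateRing) = ⊥ := by
  have := poleOrder_smul_basis (W := W) 0 0
  simpa using this

lemma poleOrder_mul (f g : W.CoordinateRing) : poleOrder (f * g) = poleOrder f + poleOrder g := by
  simp [poleOrder, map_mul, degree_mul]

lemma poleOrder_algebraMap {c : K} (hc : c ≠ 0) :
    poleOrder (algebraMap K W.CoordinateRing c) = 0 := by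
  have := poleOrder_smul_basis (W := W) (C c) 0
  rw [zero_smul, add_zero, degree_C hc] at this
  rw [show algebraMap K W.CoordinateRing c = C c • (1 : W.CoordinateRing) by
    rw [smul, mul_one]; rfl, this]
  simp

lemma poleOrder_pow (f : W.CoordinateRing) (n : ℕ) : poleOrder (f ^ n) = n • poleOrder f := by
  simp [poleOrder, map_pow, degree_pow]

lemma poleOrder_X : poleOrder (mk W (C X)) = 2 := by
  have := poleOrder_smul_basis (W := W) X 0
  rw [zero_smul, add_zero, degree_X] at this
  rw [show mk W (C X) = (X : K[X]) • (1 : W.CoordinateRing) by rw [smul, mul_one], this]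
  simp

lemma poleOrder_Y : poleOrder (mk W X) = 3 := by
  have := poleOrder_smul_basis (W := W) 0 1
  rw [zero_smul, zero_add, one_smul, degree_one] at this
  rw [this]
  simp

/-- The norm is not additive, so the inequality is read off from the coordinates in the basis `1,
Y`, where the pole order is a maximum of degrees. -/
lemma poleOrder_add_le (f g : W.CoordinateRing) :
    poleOrder (f + g) ≤ max (poleOrder f) (poleOrder g) := by
  obtain ⟨p, q, rfl⟩ := exists_smul_basis_eq f
  obtain ⟨p', q', rfl⟩ := exists_smul_basis_eq g
  rw [show p • (1 : W.CoordinateRing) + q • mk W X + (p' • (1 : W.CoordinateRing) + q' • mk W X) =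
    (p + p') • (1 : W.CoordinateRing) + (q + q') • mk W X by rw [add_smul, add_smul]; ring]
  rw [poleOrder_smul_basis, poleOrder_smul_basis, poleOrder_smul_basis]
  refine max_le ?_ ?_
  · rcases le_max_iff.1 (degree_add_le p p') with h | h
    · exact (nsmul_le_nsmul_right h 2).trans (le_max_of_le_left (le_max_left _ _))
    · exact (nsmul_le_nsmul_right h 2).trans (le_max_of_le_right (le_max_left _ _))
  · rcases le_max_iff.1 (degree_add_le q q') with h | h
    · exact (add_le_add_left (nsmul_le_nsmul_right h 2) 3).trans
        (le_max_of_le_left (le_max_right _ _))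
    · exact (add_le_add_left (nsmul_le_nsmul_right h 2) 3).trans
        (le_max_of_le_right (le_max_right _ _))

lemma poleOrder_sum_lt {ι : Type*} (s : Finset ι) (f : ι → W.CoordinateRing) (n : ℕ)
    (h : ∀ i ∈ s, poleOrder (f i) < n) : poleOrder (∑ i ∈ s, f i) < n := by
  classical
  induction s using Finset.induction_on with
  | empty => simp [poleOrder_zero]
  | insert i s hi ih =>
    rw [Finset.sum_insert hi]
    exact (poleOrder_add_le _ _).trans_lt (max_lt (h i (Finset.mem_insert_self _ _))
      (ih fun j hj => h j (Finset.mem_insert_of_mem hj)))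

lemma exists_eq_algebraMap_of_poleOrder_le_zero {f : W.CoordinateRing} (hf : poleOrder f ≤ 0) :
    ∃ c, f = algebraMap K W.CoordinateRing c := by
  obtain ⟨p, q, rfl⟩ := exists_smul_basis_eq f
  rw [poleOrder_smul_basis, max_le_iff] at hf
  have hq : q = 0 := by
    by_contra hq
    rw [degree_eq_natDegree hq] at hf
    have := hf.2
    norm_cast at this
  have hp : p.degree ≤ 0 := by
    by_cases hp : p = 0
    · simp [hp]
    rw [degree_eq_natDegree hp] at hf ⊢
    have := hf.1
    rw [two_nsmul] at this
    norm_cast at this ⊢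
    omega
  refine ⟨p.coeff 0, ?_⟩
  rw [hq, zero_smul, add_zero, smul, mul_one, eq_C_of_degree_le_zero hp, coeff_C_zero]
  rfl

variable (W) in
/-- The value of a polynomial in three variables at the generic point `[x : y : 1]`. -/
noncomputable def gen : MvPolynomial (Fin 3) K →ₐ[K] W.CoordinateRing :=
  MvPolynomial.aeval ![mk W (C X), mk W X, 1]

/-- A monomial `X^a Y^b Z^c` of degree `n` has pole order `2a + 3b ≤ 3n`, with equality only for
`Y^n`. The coefficient of `Y^n` is the value at `[0 : 1 : 0]`. -/
lemma poleOrder_gen_lt {G : MvPolynomial (Fin 3) K} {n : ℕ} (hG : G.IsHomogeneous n)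
    (h0 : MvPolynomial.eval ![0, 1, 0] G = 0) : poleOrder (gen W G) < (3 * n : ℕ) := by
  rw [gen, MvPolynomial.aeval_def, MvPolynomial.eval₂_eq']
  refine poleOrder_sum_lt _ _ _ fun m hm => ?_
  have hm' := hG (MvPolynomial.mem_support_iff.1 hm)
  rw [Finsupp.weight_apply, Finsupp.sum_fintype _ _ (by simp), Fin.sum_univ_three] at hm'
  simp only [Pi.one_apply, smul_eq_mul, mul_one] at hm'
  rw [poleOrder_mul, poleOrder_algebraMap (MvPolynomial.mem_support_iff.1 hm), Fin.prod_univ_three]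
  simp only [Matrix.cons_val_zero, Matrix.cons_val_one, Matrix.cons_val, one_pow, mul_one]
  rw [poleOrder_mul, poleOrder_pow, poleOrder_pow, poleOrder_X, poleOrder_Y, zero_add]
  have : m 1 ≠ n := by
    intro h
    have hm0 : m 0 = 0 := by omega
    have hm2 : m 2 = 0 := by omega
    apply MvPolynomial.mem_support_iff.1 hm
    rw [MvPolynomial.eval_eq'] at h0
    rw [Finset.sum_eq_single m] at h0
    · simpa [Fin.prod_univ_three, hm0, hm2] using h0
    · intro m' hm' hne
      have hm'' := hG (MvPolynomial.mem_support_iff.1 hm')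
      rw [Finsupp.weight_apply, Finsupp.sum_fintype _ _ (by simp), Fin.sum_univ_three] at hm''
      simp only [Pi.one_apply, smul_eq_mul, mul_one] at hm''
      have : m' 0 ≠ 0 ∨ m' 2 ≠ 0 := by
        by_contra! h'
        apply hne
        ext i
        fin_cases i <;> simp <;> omega
      rcases this with h' | h' <;> simp [Fin.prod_univ_three, h']
    · exact fun h' => (h' hm).elim
  rw [nsmul_eq_mul, nsmul_eq_mul]
  norm_cast
  omega

lemma poleOrder_gen {G : MvPolynomial (Fin 3) K} {n : ℕ} (hG : G.IsHomogeneous n)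
    (h0 : MvPolynomial.eval ![0, 1, 0] G ≠ 0) : poleOrder (gen W G) = (3 * n : ℕ) := by
  set c := MvPolynomial.eval ![0, 1, 0] G
  let M : MvPolynomial (Fin 3) K := MvPolynomial.C c * MvPolynomial.X 1 ^ n
  have hM : M.IsHomogeneous n := by
    simpa using (MvPolynomial.isHomogeneous_C (Fin 3) c).mul
      ((MvPolynomial.isHomogeneous_X K (1 : Fin 3)).pow n)
  have hd : poleOrder (gen W (G - M)) < (3 * n : ℕ) := poleOrder_gen_lt (hG.sub hM) (by simp [M, c])
  have hM' : poleOrder (gen W M) = (3 * n : ℕ) := by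
    simp only [M, gen, map_mul, map_pow, MvPolynomial.aeval_X, MvPolynomial.aeval_C]
    rw [poleOrder_mul, poleOrder_algebraMap h0, poleOrder_pow, zero_add]
    simp only [Matrix.cons_val_one, Matrix.cons_val_zero]
    rw [poleOrder_Y, nsmul_eq_mul]
    norm_cast
    ring
  have h1 := poleOrder_add_le (gen W (G - M)) (gen W M)
  rw [← map_add, sub_add_cancel, hM', max_eq_right hd.le] at h1
  refine le_antisymm h1 ?_
  -- For the lower bound, write the leading term as `M = G + (M - G)`; the second summand has too
  -- small a pole order to account for that of `M`.
  have h2 := poleOrder_add_le (gen W G) (gen W (M - G))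
  rw [← map_add, add_sub_cancel, hM', show M - G = MvPolynomial.C (-1) * (G - M) by simp,
    map_mul, poleOrder_mul] at h2
  have h3 : poleOrder (gen W (MvPolynomial.C (-1))) = 0 := by
    rw [gen, MvPolynomial.aeval_C]
    exact poleOrder_algebraMap (by simp)
  rw [h3, zero_add] at h2
  rcases le_max_iff.1 h2 with h | h
  · exact h
  · exact (h.not_gt hd).elim

lemma poleOrder_gen_le {G : MvPolynomial (Fin 3) K} {n : ℕ} (hG : G.IsHomogeneous n) :
    poleOrder (gen W G) ≤ (3 * n : ℕ) := by
  by_cases h0 : MvPolynomial.eval ![0, 1, 0] G = 0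
  · exact (poleOrder_gen_lt hG h0).le
  · exact (poleOrder_gen hG h0).le

/-- A homogeneous polynomial that vanishes at the generic point vanishes at infinity. -/
lemma eval_infinity_eq_zero {G : MvPolynomial (Fin 3) K} {n : ℕ} (hG : G.IsHomogeneous n)
    (h : gen W G = 0) : MvPolynomial.eval ![0, 1, 0] G = 0 := by
  by_contra h0
  have := poleOrder_gen (W := W) hG h0
  rw [h, poleOrder_zero] at this
  exact WithBot.bot_ne_natCast _ this

end PoleOrder

end WeierstrassCurve.Affine.CoordinateRing

namespace WeierstrassCurve.Affine.CoordinateRing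

open Polynomial

/-! ### Evaluation at affine points -/

section Eval

variable {K : Type*} [Field K] {W : Affine K}

lemma algHom_ext_XY {A : Type*} [CommRing A] [Algebra K A] {f g : W.CoordinateRing →ₐ[K] A}
    (hX : f (mk W (C X)) = g (mk W (C X))) (hY : f (mk W X) = g (mk W X)) : f = g := by
  refine AdjoinRoot.algHom_ext' ?_ hY
  exact Polynomial.algHom_ext hX

lemma mk_equation :
    mk W X ^ 2 + algebraMap K _ W.a₁ * mk W (C X) * mk W X + algebraMap K _ W.a₃ * mk W X =
      mk W (C X) ^ 3 + algebraMap K _ W.a₂ * mk W (C X) ^ 2 + algebraMap K _ W.a₄ * mk W (C X) +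
        algebraMap K _ W.a₆ := by
  have h : mk W W.polynomial = 0 := AdjoinRoot.mk_self
  simp only [polynomial, map_add, map_sub, map_mul, map_pow] at h
  have hc (c : K) : mk W (C (C c)) = algebraMap K _ c := rfl
  simp only [hc] at h
  linear_combination h

/-- The algebra homomorphism on the affine coordinate ring given by a solution of the Weierstrass
equation. -/
noncomputable def liftXY {A : Type*} [CommRing A] [Algebra K A] (a b : A)
    (h : b ^ 2 + algebraMap K A W.a₁ * a * b + algebraMap K A W.a₃ * b =
      a ^ 3 + algebraMap K A W.a₂ * a ^ 2 + algebraMap K A W.a₄ * a + algebraMap K A W.a₆) :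
    W.CoordinateRing →ₐ[K] A :=
  AdjoinRoot.liftAlgHom W.polynomial (Polynomial.aeval a) b (by
    simp only [polynomial, eval₂_add, eval₂_sub, eval₂_mul, eval₂_X, eval₂_C, eval₂_pow,
      RingHom.coe_coe, map_add, map_mul, map_pow, aeval_X, aeval_C]
    linear_combination h)

section

variable {A : Type*} [CommRing A] [Algebra K A] {a b : A}
    (h : b ^ 2 + algebraMap K A W.a₁ * a * b + algebraMap K A W.a₃ * b =
      a ^ 3 + algebraMap K A W.a₂ * a ^ 2 + algebraMap K A W.a₄ * a + algebraMap K A W.a₆)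

lemma liftXY_X : liftXY a b h (mk W (C X)) = a := by
  simp [liftXY]

lemma liftXY_Y : liftXY a b h (mk W X) = b := by
  simp [liftXY]

lemma liftXY_gen (G : MvPolynomial (Fin 3) K) :
    liftXY a b h (gen W G) = MvPolynomial.aeval ![a, b, 1] G := by
  rw [gen, ← AlgHom.comp_apply]
  congr 1
  ext i
  fin_cases i
  · simpa using liftXY_X h
  · simpa using liftXY_Y h
  · simp

end

instance : Algebra.FiniteType K W.CoordinateRing :=
  Algebra.FiniteType.trans (S := K[X]) inferInstance
    (haveI := Module.Finite.of_basis (CoordinateRing.basis W); inferInstance)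

/-- By Zariski's lemma the residue field is finite over the algebraically closed field `K`, hence
equal to it. -/
lemma exists_algHom_ker_eq [IsAlgClosed K] (M : Ideal W.CoordinateRing) [M.IsMaximal] :
    ∃ f : W.CoordinateRing →ₐ[K] K, ∀ r, f r = 0 ↔ r ∈ M := by
  let _ : Field (W.CoordinateRing ⧸ M) := Ideal.Quotient.field M
  have : Algebra.FiniteType K (W.CoordinateRing ⧸ M) :=
    .of_surjective (Ideal.Quotient.mkₐ K M) Ideal.Quotient.mk_surjective
  have : Module.Finite K (W.CoordinateRing ⧸ M) := finite_of_finite_type_of_isJacobsonRing _ _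
  let e : K ≃ₐ[K] (W.CoordinateRing ⧸ M) := .ofBijective (Algebra.ofId _ _)
    (IsAlgClosed.algebraMap_bijective_of_isIntegral (k := K))
  refine ⟨(e.symm : _ →ₐ[K] K).comp (Ideal.Quotient.mkₐ K M), fun r => ?_⟩
  refine (map_eq_zero_iff e.symm e.symm.injective).trans ?_
  exact Ideal.Quotient.eq_zero_iff_mem

lemma exists_algHom_of_ne_top [IsAlgClosed K] {I : Ideal W.CoordinateRing} (hI : I ≠ ⊤) :
    ∃ f : W.CoordinateRing →ₐ[K] K, ∀ r ∈ I, f r = 0 := by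
  obtain ⟨M, hM, hIM⟩ := I.exists_le_maximal hI
  obtain ⟨f, hf⟩ := exists_algHom_ker_eq M
  exact ⟨f, fun r hr => (hf r).2 (hIM hr)⟩

/-- The coordinate ring is a Jacobson domain, so the intersection of its maximal ideals is zero, and
each maximal ideal is the kernel of an evaluation. -/
lemma eq_zero_of_algHom_eq_zero [IsAlgClosed K] {r : W.CoordinateRing}
    (h : ∀ f : W.CoordinateRing →ₐ[K] K, f r = 0) : r = 0 := by
  have : IsJacobsonRing W.CoordinateRing := isJacobsonRing_of_finiteType (A := K)
  have hb : (⊥ : Ideal W.CoordinateRing).jacobson = ⊥ :=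
    IsJacobsonRing.out this (Ideal.isPrime_bot.isRadical)
  rw [← Ideal.mem_bot, ← hb, Ideal.jacobson, Ideal.mem_sInf]
  rintro M ⟨-, hM⟩
  obtain ⟨f, hf⟩ := exists_algHom_ker_eq M
  exact (hf r).1 (h f)

lemma algHom_equation (f : W.CoordinateRing →ₐ[K] K) :
    W.Equation (f (mk W (C X))) (f (mk W X)) := by
  have := congrArg f (mk_equation (W := W))
  simp only [map_add, map_mul, map_pow, AlgHom.commutes, Algebra.algebraMap_self,
    RingHom.id_apply] at this
  rw [equation_iff]
  exact this

lemma algHom_gen (f : W.CoordinateRing →ₐ[K] K) (G : MvPolynomial (Fin 3) K) :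
    f (gen W G) = MvPolynomial.eval ![f (mk W (C X)), f (mk W X), 1] G := by
  rw [gen, ← AlgHom.comp_apply, ← MvPolynomial.coe_aeval_eq_eval, AlgHom.coe_toRingHom]
  congr 1
  ext i
  fin_cases i <;> simp

/-- A polynomial that vanishes at all affine points vanishes at the generic point. -/
lemma gen_eq_zero_iff [IsAlgClosed K] (G : MvPolynomial (Fin 3) K) :
    gen W G = 0 ↔ ∀ a b, W.Equation a b → MvPolynomial.eval ![a, b, 1] G = 0 := by
  refine ⟨fun h a b hab => ?_, fun h => eq_zero_of_algHom_eq_zero fun f => ?_⟩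
  · have := liftXY_gen (W := W) (A := K) ((equation_iff _ _).1 hab) G
    rw [h, map_zero] at this
    rw [← MvPolynomial.coe_aeval_eq_eval]
    exact this.symm
  · rw [algHom_gen]
    exact h _ _ (algHom_equation f)

/-- A rational function that is regular at all points of a projective Weierstrass curve is
constant. -/
theorem eq_algebraMap_of_regular [IsAlgClosed K] {L : Type*} [Field L] [Algebra W.CoordinateRing L]
    [IsFractionRing W.CoordinateRing L] {h : L}
    (haff : ∀ a b, W.Equation a b → ∃ A B : MvPolynomial (Fin 3) K,
      MvPolynomial.eval ![a, b, 1] B ≠ 0 ∧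
        h * algebraMap _ L (gen W B) = algebraMap _ L (gen W A))
    (hinf : ∃ (n : ℕ) (A B : MvPolynomial (Fin 3) K), A.IsHomogeneous n ∧ B.IsHomogeneous n ∧
      MvPolynomial.eval ![0, 1, 0] B ≠ 0 ∧
        h * algebraMap _ L (gen W B) = algebraMap _ L (gen W A)) :
    ∃ c, h = algebraMap W.CoordinateRing L (algebraMap K _ c) := by
  -- `J` is the ideal of denominators of `h`. Regularity at every affine point keeps it out of all
  -- maximal ideals, so `h` lies in the coordinate ring.
  let J : Ideal W.CoordinateRing :=
    { carrier := {b | ∃ r : W.CoordinateRing, h * algebraMap _ L b = algebraMap _ L r}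
      zero_mem' := ⟨0, by simp⟩
      add_mem' := by
        rintro a b ⟨r, hr⟩ ⟨s, hs⟩
        exact ⟨r + s, by rw [map_add, map_add, mul_add, hr, hs]⟩
      smul_mem' := by
        rintro c b ⟨r, hr⟩
        exact ⟨c * r, by rw [smul_eq_mul, map_mul, map_mul, ← hr]; ring⟩ }
  have hJ : J = ⊤ := by
    by_contra hJ
    obtain ⟨f, hf⟩ := exists_algHom_of_ne_top hJ
    obtain ⟨A, B, hB, hAB⟩ := haff _ _ (algHom_equation f)
    rw [← algHom_gen] at hB
    exact hB (hf _ ⟨_, hAB⟩)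
  obtain ⟨r, hr⟩ : (1 : W.CoordinateRing) ∈ J := hJ ▸ Submodule.mem_top
  rw [map_one, mul_one] at hr
  -- At infinity `B` attains the maximal pole order `3n` and `A` does not exceed it, so `h` has no
  -- pole there.
  obtain ⟨n, A, B, hA, hB, hB0, hAB⟩ := hinf
  rw [hr, ← map_mul] at hAB
  have hAB' := congrArg poleOrder (IsFractionRing.injective W.CoordinateRing L hAB)
  rw [poleOrder_mul, poleOrder_gen hB hB0] at hAB'
  have hle : poleOrder r + (3 * n : ℕ) ≤ (3 * n : ℕ) := hAB' ▸ poleOrder_gen_le hA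
  have h0 : poleOrder r ≤ 0 := by
    rcases hp : poleOrder r with _ | m
    · exact bot_le
    · rw [hp] at hle
      change ((m : ℕ) : WithBot ℕ) + _ ≤ _ at hle
      change ((m : ℕ) : WithBot ℕ) ≤ _
      norm_cast at hle ⊢
      omega
  obtain ⟨c, rfl⟩ := exists_eq_algebraMap_of_poleOrder_le_zero h0
  exact ⟨c, hr⟩

end Eval

end WeierstrassCurve.Affine.CoordinateRing

namespace WeierstrassCurve.Affine.FunctionField

open Polynomial CoordinateRing

/-! ### The invariant derivation of the function field -/

section Derivation

variable {K : Type*} [Field K] (W : Affine K) (L : Type*) [Field L] [Algebra K L]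
  [Algebra W.CoordinateRing L] [IsFractionRing W.CoordinateRing L]
  [IsScalarTower K W.CoordinateRing L]

/-- The `x`-coordinate function. -/
noncomputable def genX : L := algebraMap W.CoordinateRing L (CoordinateRing.mk W (C X))

/-- The `y`-coordinate function. -/
noncomputable def genY : L := algebraMap W.CoordinateRing L (CoordinateRing.mk W X)

omit [IsFractionRing W.CoordinateRing L] in
lemma gen_equation :
    genY W L ^ 2 + algebraMap K L W.a₁ * genX W L * genY W L + algebraMap K L W.a₃ * genY W L =
      genX W L ^ 3 + algebraMap K L W.a₂ * genX W L ^ 2 + algebraMap K L W.a₄ * genX W L +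
        algebraMap K L W.a₆ := by
  have := congrArg (algebraMap W.CoordinateRing L) (mk_equation (W := W))
  simpa only [map_add, map_mul, map_pow, ← IsScalarTower.algebraMap_apply, genX, genY] using this

omit [IsFractionRing W.CoordinateRing L] in
lemma algebraMap_mk_C (p : K[X]) :
    algebraMap W.CoordinateRing L (CoordinateRing.mk W (C p)) = aeval (genX W L) p := by
  have h : CoordinateRing.mk W (C p) = aeval (CoordinateRing.mk W (C X)) p := by
    have : (AdjoinRoot.ofAlgHom K W.polynomial) = aeval (CoordinateRing.mk W (C X)) :=
      Polynomial.algHom_ext (by simp)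
    exact congrArg (fun f => f p) this
  rw [h, genX, aeval_algebraMap_apply]

omit [IsFractionRing W.CoordinateRing L] in
lemma algebraMap_gen (G : MvPolynomial (Fin 3) K) :
    algebraMap W.CoordinateRing L (gen W G) =
      MvPolynomial.aeval ![genX W L, genY W L, 1] G := by
  rw [gen, ← MvPolynomial.aeval_algebraMap_apply]
  congr 2
  ext i
  fin_cases i <;> simp [genX, genY]

omit [IsFractionRing W.CoordinateRing L] in
lemma exists_eq_aeval_add (r : W.CoordinateRing) : ∃ p q : K[X],
    algebraMap W.CoordinateRing L r = aeval (genX W L) p + aeval (genX W L) q * genY W L := by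
  obtain ⟨p, q, rfl⟩ := exists_smul_basis_eq r
  refine ⟨p, q, ?_⟩
  rw [smul, smul, map_add, map_mul, map_mul, map_one, mul_one, algebraMap_mk_C, algebraMap_mk_C,
    genY]

lemma two_mul_genY_ne_zero [CharZero K] :
    2 * genY W L + algebraMap K L W.a₁ * genX W L + algebraMap K L W.a₃ ≠ 0 := by
  have : 2 * genY W L + algebraMap K L W.a₁ * genX W L + algebraMap K L W.a₃ =
      algebraMap W.CoordinateRing L
        ((C W.a₁ * X + C W.a₃ : K[X]) • (1 : W.CoordinateRing) +
          (C 2 : K[X]) • CoordinateRing.mk W X) := by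
    rw [smul, smul, map_add, map_mul, map_mul, map_one, mul_one, algebraMap_mk_C, algebraMap_mk_C,
      genY]
    simp only [map_add, map_mul, aeval_C, aeval_X, map_ofNat (algebraMap K L) 2]
    ring
  rw [this, map_ne_zero_iff _ (IsFractionRing.injective W.CoordinateRing L)]
  exact fun h => two_ne_zero (C_eq_zero.1 (smul_basis_eq_zero h).2)

lemma transcendental_genX : Transcendental K (genX W L) := by
  rw [transcendental_iff]
  intro p hp
  rw [← algebraMap_mk_C, map_eq_zero_iff _ (IsFractionRing.injective W.CoordinateRing L)] at hp
  refine (smul_basis_eq_zero (W' := W) (p := p) (q := 0) ?_).1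
  rw [zero_smul, add_zero, smul, mul_one, hp]

lemma isAlgebraic_adjoin_genX : Algebra.IsAlgebraic (Algebra.adjoin K {genX W L}) L := by
  have hp (p : K[X]) : IsAlgebraic (Algebra.adjoin K {genX W L}) (aeval (genX W L) p) :=
    isAlgebraic_algebraMap (⟨_, aeval_mem_adjoin_singleton K (genX W L)⟩ : Algebra.adjoin K _)
  have hy : IsAlgebraic (Algebra.adjoin K {genX W L}) (genY W L) := by
    refine IsIntegral.isAlgebraic ⟨X ^ 2 +
      (C ⟨aeval (genX W L) (C W.a₁ * X + C W.a₃), aeval_mem_adjoin_singleton K _⟩ * X -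
        C ⟨aeval (genX W L) (X ^ 3 + C W.a₂ * X ^ 2 + C W.a₄ * X + C W.a₆),
          aeval_mem_adjoin_singleton K _⟩), monic_X_pow_add (by compute_degree!), ?_⟩
    simp
    linear_combination gen_equation W L
  refine ⟨fun z => ?_⟩
  obtain ⟨r, s, -, rfl⟩ := IsFractionRing.div_surjective (A := W.CoordinateRing) z
  have hr (r : W.CoordinateRing) :
      IsAlgebraic (Algebra.adjoin K {genX W L}) (algebraMap W.CoordinateRing L r) := by
    obtain ⟨p, q, h⟩ := exists_eq_aeval_add W L r
    rw [h]
    exact (hp p).add ((hp q).mul hy)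
  rw [div_eq_mul_inv]
  exact (hr r).mul (hr s).inv

/-- The derivation of the function field that is dual to the invariant differential. -/
theorem exists_derivation : ∃ D : Derivation K L L,
    D (genX W L) = 2 * genY W L + algebraMap K L W.a₁ * genX W L + algebraMap K L W.a₃ ∧
    D (genY W L) = 3 * genX W L ^ 2 + 2 * algebraMap K L W.a₂ * genX W L + algebraMap K L W.a₄ -
      algebraMap K L W.a₁ * genY W L := by
  set x := genX W L
  set y := genY W L
  set u := 2 * y + algebraMap K L W.a₁ * x + algebraMap K L W.a₃ with hu
  set v := 3 * x ^ 2 + 2 * algebraMap K L W.a₂ * x + algebraMap K L W.a₄ -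
      algebraMap K L W.a₁ * y with hv
  have hc (c : K) : algebraMap K (TrivSqZeroExt L L) c = TrivSqZeroExt.inl (algebraMap K L c) := rfl
  have e := gen_equation W L
  -- A derivation is a homomorphism to the dual numbers lifting the identity. The pair `(x + εu, y +
  -- εv)` solves the Weierstrass equation because `(u, v)` is tangent to the curve. The map extends
  -- to fractions since units of the dual numbers are detected by the first component.
  let ψ : W.CoordinateRing →ₐ[K] TrivSqZeroExt L L :=
    liftXY (TrivSqZeroExt.inl x + TrivSqZeroExt.inr u) (TrivSqZeroExt.inl y + TrivSqZeroExt.inr v)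
      (by
        simp only [hc]
        ext
        · simpa using e
        · simp [pow_succ]
          rw [hu, hv]
          ring)
  have hfst (r) : (ψ r).fst = algebraMap W.CoordinateRing L r := by
    have : (TrivSqZeroExt.fstHom K L L).comp ψ = IsScalarTower.toAlgHom K W.CoordinateRing L :=
      algHom_ext_XY
        (by
          change (ψ (CoordinateRing.mk W (C X))).fst = x
          rw [liftXY_X]
          simp)
        (by
          change (ψ (CoordinateRing.mk W X)).fst = y
          rw [liftXY_Y]
          simp)
    exact congrArg (fun f => f r) this
  have hunit (s : nonZeroDivisors W.CoordinateRing) : IsUnit (ψ s) := by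
    rw [TrivSqZeroExt.isUnit_iff_isUnit_fst, hfst]
    exact IsLocalization.map_units L s
  let Ψ : L →+* TrivSqZeroExt L L :=
    IsLocalization.lift (M := nonZeroDivisors W.CoordinateRing) (g := (ψ : _ →+* _)) hunit
  have hΨ (r) : Ψ (algebraMap W.CoordinateRing L r) = ψ r := IsLocalization.lift_eq _ _
  have hΨfst (z : L) : (Ψ z).fst = z := by
    have : (TrivSqZeroExt.fstHom L L L : _ →+* L).comp Ψ = RingHom.id L :=
      IsLocalization.ringHom_ext (nonZeroDivisors W.CoordinateRing) 
        (RingHom.ext fun r => by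
          change (Ψ (algebraMap W.CoordinateRing L r)).fst = _
          rw [hΨ, hfst]
          rfl)
    exact congrArg (fun f => f z) this
  have hΨc (c : K) : Ψ (algebraMap K L c) = algebraMap K _ c := by
    rw [IsScalarTower.algebraMap_apply K W.CoordinateRing L, hΨ, AlgHom.commutes]
  let D : Derivation K L L := Derivation.mk'
    { toFun := fun z => (Ψ z).snd
      map_add' := fun a b => by simp
      map_smul' := fun c a => by
        rw [Algebra.smul_def, map_mul, TrivSqZeroExt.snd_mul, hΨfst, hΨfst, hΨc, hc]
        simp [Algebra.smul_def] }
    (fun a b => by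
      change (Ψ (a * b)).snd = a • (Ψ b).snd + b • (Ψ a).snd
      rw [map_mul, TrivSqZeroExt.snd_mul, hΨfst, hΨfst]
      simp [mul_comm])
  refine ⟨D, ?_, ?_⟩
  · change (Ψ x).snd = u
    simp only [x, genX, hΨ, ψ, liftXY_X]
    simp
  · change (Ψ y).snd = v
    simp only [y, genY, hΨ, ψ, liftXY_Y]
    simp

variable {W L}

/-- The constants of a nonzero derivation of the function field are the elements of the base
field. -/
theorem eq_algebraMap_of_derivation_eq_zero [CharZero K] [IsAlgClosed K] (D : Derivation K L L)
    (hD : D (genX W L) ≠ 0) {f : L} (hf : D f = 0) : ∃ c, f = algebraMap K L c := by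
  by_cases hfa : IsAlgebraic K f
  · obtain ⟨c, hc⟩ := (IsAlgClosed.algebraMap_bijective_of_isIntegral (k := K)
      (K := integralClosure K L)).2 ⟨f, hfa.isIntegral⟩
    exact ⟨c, (congrArg Subtype.val hc).symm⟩
  -- If `f` is transcendental, then `L`, of transcendence degree at most 1, is algebraic over
  -- `K(f)`. Now `D` vanishes on `K(f)`, and a derivation vanishes on elements separable algebraic
  -- over its constants, so `D x = 0`.
  exfalso
  have halg := isAlgebraic_adjoin_genX W L
  have htr : Algebra.trdeg K L ≤ 1 := by
    simpa using Algebra.IsAlgebraic.trdeg_le_cardinalMk K {genX W L}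
  have hind : AlgebraicIndependent K ((↑) : ({f} : Set L) → L) :=
    algebraicIndependent_unique_type_iff.2 hfa
  have hbasis := (hind.isTranscendenceBasis_of_trdeg_le_of_finite
    (by simpa using htr)).isAlgebraic_field
  rw [Subtype.range_coe] at hbasis
  have hcst (z : L) (hz : z ∈ IntermediateField.adjoin K {f}) : D z = 0 := by
    induction hz using IntermediateField.adjoin_induction with
    | mem z hz => rw [Set.mem_singleton_iff.1 hz, hf]
    | algebraMap c => exact D.map_algebraMap c
    | add a b _ _ ha hb => rw [map_add, ha, hb, add_zero]
    | inv a _ ha => rw [Derivation.leibniz_inv, ha, smul_zero]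
    | mul a b _ _ ha hb => rw [Derivation.leibniz, ha, hb, smul_zero, smul_zero, add_zero]
  let D' : Derivation (IntermediateField.adjoin K {f}) L L := Derivation.mk'
    { toFun := D
      map_add' := map_add D
      map_smul' := fun c a => by
        rw [Algebra.smul_def, Derivation.leibniz]
        simp [hcst _ c.2, Algebra.smul_def] }
    (fun a b => D.leibniz a b)
  have hx : IsAlgebraic (IntermediateField.adjoin K {f}) (genX W L) := hbasis.isAlgebraic _
  have hm := D'.map_aeval (minpoly _ (genX W L)) (genX W L)
  rw [minpoly.aeval, map_zero, eq_comm, smul_eq_mul, mul_eq_zero] at hm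
  refine hm.elim (fun h => ?_) hD
  exact (minpoly.irreducible hx.isIntegral).separable.aeval_derivative_ne_zero
    (minpoly.aeval _ _) h

/-- Solutions in `L` of the Weierstrass equation with transcendental first coordinate define
endomorphisms of the function field. -/
theorem exists_algHom {a b : L} (ha : Transcendental K a)
    (h : b ^ 2 + algebraMap K L W.a₁ * a * b + algebraMap K L W.a₃ * b =
      a ^ 3 + algebraMap K L W.a₂ * a ^ 2 + algebraMap K L W.a₄ * a + algebraMap K L W.a₆) :
    ∃ τ : L →ₐ[K] L, τ (genX W L) = a ∧ τ (genY W L) = b := by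
  have : Module.Finite K[X] W.CoordinateRing := .of_basis (CoordinateRing.basis W)
  -- The norm of a kernel element is a multiple of it, hence a polynomial in `X` that vanishes at
  -- the transcendental `a`. So the norm is zero, and with it the element.
  have hinj : Function.Injective (liftXY a b h) := by
    rw [injective_iff_map_eq_zero]
    intro f hf
    by_contra hf0
    obtain ⟨p, q, rfl⟩ := exists_smul_basis_eq f
    have hN := coe_norm_smul_basis (W' := W) p q
    have h1 : p • (1 : W.CoordinateRing) + q • CoordinateRing.mk W X =
        CoordinateRing.mk W (C p + C q * X) := by
      rw [smul, smul, map_add, map_mul, mul_one]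
    rw [map_mul, ← h1] at hN
    have hN' := congrArg (liftXY a b h) hN
    rw [map_mul, hf, zero_mul] at hN'
    have h2 (r : K[X]) : liftXY a b h (CoordinateRing.mk W (C r)) = aeval a r := by
      simp [liftXY]
    refine hf0 (Algebra.norm_eq_zero_iff.1 ((transcendental_iff.1 ha) _ ((h2 _).symm.trans hN')))
  refine ⟨IsFractionRing.liftAlgHom (g := liftXY a b h) hinj, ?_, ?_⟩
  · rw [genX, IsFractionRing.liftAlgHom_apply, IsFractionRing.lift_algebraMap]
    exact liftXY_X h
  · rw [genY, IsFractionRing.liftAlgHom_apply, IsFractionRing.lift_algebraMap]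
    exact liftXY_Y h

lemma algHom_ext_gen {τ τ' : L →ₐ[K] L} (hx : τ (genX W L) = τ' (genX W L))
    (hy : τ (genY W L) = τ' (genY W L)) : τ = τ' := by
  have : τ.comp (IsScalarTower.toAlgHom K W.CoordinateRing L) =
      τ'.comp (IsScalarTower.toAlgHom K W.CoordinateRing L) := algHom_ext_XY hx hy
  ext z
  obtain ⟨r, s, -, rfl⟩ := IsFractionRing.div_surjective (A := W.CoordinateRing) z
  have h (r : W.CoordinateRing) : τ (algebraMap _ L r) = τ' (algebraMap _ L r) :=
    congrArg (fun f => f r) this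
  rw [map_div₀, map_div₀, h, h]

/-- An endomorphism commutes with a derivation if it does so on the coordinate functions. -/
theorem derivation_comm (D : Derivation K L L) (τ : L →ₐ[K] L)
    (hx : D (τ (genX W L)) = τ (D (genX W L))) (hy : D (τ (genY W L)) = τ (D (genY W L))) (z : L) :
    D (τ z) = τ (D z) := by
  have hp (p : K[X]) : D (τ (aeval (genX W L) p)) = τ (D (aeval (genX W L) p)) := by
    rw [← aeval_algHom_apply, Derivation.map_aeval, Derivation.map_aeval, smul_eq_mul, smul_eq_mul,
      map_mul, hx, aeval_algHom_apply]
  have hr (r : W.CoordinateRing) : D (τ (algebraMap _ L r)) = τ (D (algebraMap _ L r)) := by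
    obtain ⟨p, q, h⟩ := exists_eq_aeval_add W L r
    rw [h]
    simp only [map_add, map_mul, Derivation.leibniz, smul_eq_mul, hp, hy]
  obtain ⟨r, s, hs, rfl⟩ := IsFractionRing.div_surjective (A := W.CoordinateRing) z
  have hs0 : algebraMap _ L s ≠ 0 :=
    (map_ne_zero_iff _ (IsFractionRing.injective W.CoordinateRing L)).2 (nonZeroDivisors.ne_zero hs)
  set z := algebraMap _ L r / algebraMap _ L s with hz
  have hzr : algebraMap _ L r = z * algebraMap _ L s := by rw [hz, div_mul_cancel₀ _ hs0]
  have h1 := hr r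
  rw [hzr] at h1
  simp only [map_mul, Derivation.leibniz, smul_eq_mul, map_add, hr s] at h1
  have hτ : τ (algebraMap _ L s) ≠ 0 := (map_ne_zero_iff _ τ.injective).2 hs0
  refine mul_left_cancel₀ hτ ?_
  linear_combination h1

end Derivation

end WeierstrassCurve.Affine.FunctionField

namespace WeierstrassCurve.Affine.Point

/-! ### Homogeneous coordinates of points -/

section Coords

variable {F : Type*} [Field F] {W : Affine F}

/-- Homogeneous coordinates of a point. -/
def coords : W.Point → Fin 3 → F
  | .zero => ![0, 1, 0]
  | .some x y _ => ![x, y, 1]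

lemma coords_zero : coords (0 : W.Point) = ![0, 1, 0] := rfl

lemma coords_some {x y : F} (h : W.Nonsingular x y) : coords (.some x y h) = ![x, y, 1] := rfl

/-- The vector `v` consists of homogeneous coordinates of the point `P`. -/
def Represents (v : Fin 3 → F) (P : W.Point) : Prop :=
  ∃ c : F, c ≠ 0 ∧ ∀ i, v i = c * coords P i

lemma represents_coords (P : W.Point) : Represents (coords P) P := ⟨1, one_ne_zero, by simp⟩

lemma nonsingular_coords (P : W.Point) : W.toProjective.Nonsingular (coords P) := by
  rcases P with _ | ⟨x, y, h⟩
  · exact Projective.nonsingular_zero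
  · exact (Projective.nonsingular_some x y).2 h

lemma toAffine_coords (P : W.Point) : Projective.Point.toAffine W (coords P) = P := by
  rcases P with _ | ⟨x, y, h⟩
  · exact Projective.Point.toAffine_zero
  · exact Projective.Point.toAffine_some ((Projective.nonsingular_some x y).2 h)

/-- This connects representing vectors with `Projective.Point.toAffine`, so that the projective
addition formulas become available. -/
lemma represents_iff {v : Fin 3 → F} {P : W.Point} :
    Represents v P ↔ W.toProjective.Nonsingular v ∧ Projective.Point.toAffine W v = P := by
  constructor
  · rintro ⟨c, hc, hv⟩
    obtain rfl : v = c • coords P := funext hv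
    rw [Projective.nonsingular_smul _ hc.isUnit, Projective.Point.toAffine_smul _ hc.isUnit]
    exact ⟨nonsingular_coords P, toAffine_coords P⟩
  · rintro ⟨hv, rfl⟩
    by_cases hz : v 2 = 0
    · rw [Projective.Point.toAffine_of_Z_eq_zero hz]
      have hx := Projective.X_eq_zero_of_Z_eq_zero hv.1 hz
      refine ⟨v 1, (Projective.isUnit_Y_of_Z_eq_zero hv hz).ne_zero, fun i => ?_⟩
      fin_cases i <;> simp [coords_zero, hx, hz]
    · rw [Projective.Point.toAffine_of_Z_ne_zero hv hz]
      refine ⟨v 2, hz, fun i => ?_⟩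
      fin_cases i <;> simp [coords_some] <;> field_simp

lemma Represents.unique {v : Fin 3 → F} {P Q : W.Point} (hP : Represents v P)
    (hQ : Represents v Q) : P = Q :=
  (represents_iff.1 hP).2.symm.trans (represents_iff.1 hQ).2

lemma Represents.smul {v : Fin 3 → F} {P : W.Point} (hP : Represents v P) {c : F} (hc : c ≠ 0) :
    Represents (fun i => c * v i) P := by
  obtain ⟨d, hd, h⟩ := hP
  exact ⟨c * d, mul_ne_zero hc hd, fun i => by simp only [h]; ring⟩

lemma Represents.ne_zero {v : Fin 3 → F} {P : W.Point} (hP : Represents v P) : ∃ i, v i ≠ 0 := by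
  obtain ⟨c, hc, h⟩ := hP
  rcases P with _ | ⟨x, y, h'⟩
  · exact ⟨1, by rw [h]; simpa [coords] using hc⟩
  · exact ⟨2, by rw [h]; simpa [coords] using hc⟩

lemma Represents.cross_eq {v w : Fin 3 → F} {P : W.Point} (hv : Represents v P)
    (hw : Represents w P) (i j : Fin 3) : v i * w j = v j * w i := by
  obtain ⟨c, -, hv⟩ := hv
  obtain ⟨d, -, hw⟩ := hw
  rw [hv, hv, hw, hw]
  ring

/-- Proportionality is phrased by vanishing 2×2 minors because these are polynomial identities,
which can be carried between closed points and the generic point. -/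
lemma Represents.of_cross_eq {v w : Fin 3 → F} {P : W.Point} (hv : Represents v P)
    (hw : ∃ i, w i ≠ 0) (h : ∀ i j, v i * w j = v j * w i) : Represents w P := by
  obtain ⟨j, hj⟩ := hv.ne_zero
  obtain ⟨c, hc, hv'⟩ := hv
  have hw' (i : Fin 3) : w i = w j / v j * v i := by
    field_simp
    linear_combination -h i j
  have hwj : w j ≠ 0 := by
    intro hwj
    obtain ⟨i, hi⟩ := hw
    exact hi (by rw [hw' i, hwj, zero_div, zero_mul])
  refine ⟨w j / v j * c, mul_ne_zero (div_ne_zero hwj hj) hc, fun i => ?_⟩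
  rw [hw' i, hv' i]
  ring

lemma eq_of_cross_eq {v w : Fin 3 → F} {P Q : W.Point} (hv : Represents v P) (hw : Represents w Q)
    (h : ∀ i j, v i * w j = v j * w i) : P = Q :=
  (hv.of_cross_eq hw.ne_zero h).unique hw

lemma Represents.add [DecidableEq F] {v w : Fin 3 → F} {P Q : W.Point} (hv : Represents v P)
    (hw : Represents w Q) (hPQ : P ≠ Q) :
    Represents (W.toProjective.addXYZ v w) (P + Q) := by
  have h : ¬ Projective.instSetoidForallFinOfNatNat.r v w := by
    rintro ⟨u, hu⟩
    obtain rfl : v = fun i => (u : F) * w i := funext fun i => (congrFun hu i).symm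
    exact hPQ (hv.unique (hw.smul u.ne_zero))
  rw [← Projective.add_of_not_equiv h, represents_iff]
  rw [represents_iff] at hv hw
  refine ⟨Projective.nonsingular_add hv.1 hw.1, ?_⟩
  rw [Projective.Point.toAffine_add hv.1 hw.1, hv.2, hw.2]

lemma exists_represents [W.IsElliptic] {v : Fin 3 → F} (hv : ∃ i, v i ≠ 0)
    (h : W.toProjective.Equation v) : ∃ P : W.Point, Represents v P := by
  by_cases hz : v 2 = 0
  · have hx := Projective.X_eq_zero_of_Z_eq_zero h hz
    refine ⟨0, v 1, fun hy => ?_, fun i => ?_⟩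
    · obtain ⟨i, hi⟩ := hv
      fin_cases i <;> exact hi ‹_›
    · fin_cases i <;> simp [coords_zero, hx, hz]
  · rw [Projective.equation_of_Z_ne_zero hz] at h
    refine ⟨Point.mk h, v 2, hz, fun i => ?_⟩
    fin_cases i <;> simp [Point.mk, coords_some] <;> field_simp

/-- The cross product of `v` with `D v` is proportional to the gradient of the cubic, with factor
`d`. Both sides scale quadratically in `v`, since the derivative of a scalar factor cancels in the
cross product. Hence `d` is a quotient with regular denominator wherever some partial derivative is
nonzero. -/
lemma Represents.derivation_cross {A : Type*} [CommRing A] [Algebra A F] {D : Derivation A F F}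
    {v : Fin 3 → F} {P : W.Point} (hv : Represents v P) {d : F}
    (hd : IsLogDeriv D P d) :
    D (v 0) * v 2 - v 0 * D (v 2) = d * MvPolynomial.eval v W.toProjective.polynomialY ∧
    v 1 * D (v 2) - D (v 1) * v 2 = d * MvPolynomial.eval v W.toProjective.polynomialX ∧
    v 0 * D (v 1) - D (v 0) * v 1 = d * MvPolynomial.eval v W.toProjective.polynomialZ := by
  obtain ⟨c, -, hv⟩ := hv
  rw [Projective.eval_polynomialX, Projective.eval_polynomialY, Projective.eval_polynomialZ]
  rcases P with _ | ⟨x, y, h⟩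
  · rw [← zero_def, isLogDeriv_zero_iff] at hd
    have h0 : v 0 = 0 := by simp [hv, coords]
    have h2 : v 2 = 0 := by simp [hv, coords]
    simp [h0, h2, hd]
  · rw [isLogDeriv_some_iff] at hd
    have h0 : v 0 = c * x := by simp [hv, coords]
    have h1 : v 1 = c * y := by simp [hv, coords]
    have h2 : v 2 = c := by simp [hv, coords]
    have e := (W.equation_iff _ _).1 h.1
    simp only [h0, h1, h2, Derivation.leibniz, smul_eq_mul, hd.1, hd.2]
    refine ⟨by ring, by ring, ?_⟩
    linear_combination (-3 * c ^ 2 * d) * e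

end Coords

section Map

variable {R S F K : Type*} [Field R] [Field S] [Field F] [Field K] [Algebra R S] [Algebra R F]
  [Algebra S F] [IsScalarTower R S F] [Algebra R K] [Algebra S K] [IsScalarTower R S K]
  {W : WeierstrassCurve R} [DecidableEq F] [DecidableEq K] (f : F →ₐ[S] K)

lemma coords_map (P : (W.baseChange F).toAffine.Point) (i : Fin 3) :
    coords (map f P) i = f (coords P i) := by
  rcases P with _ | ⟨x, y, h⟩
  · fin_cases i <;> simp [coords, map]
  · fin_cases i <;> simp [coords, map]

lemma Represents.map {P : (W.baseChange F).toAffine.Point} {v : Fin 3 → F} (h : Represents v P) :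
    Represents (fun i => f (v i)) (Point.map f P) := by
  obtain ⟨c, hc, h⟩ := h
  exact ⟨f c, (map_ne_zero_iff _ f.injective).2 hc, fun i => by simp only [h, map_mul, coords_map]⟩

end Map

end WeierstrassCurve.Affine.Point

/-! ### Morphisms given by homogeneous polynomials, and their generic values -/

namespace WeierstrassCurve

open WeierstrassCurve.Affine Affine.Point Affine.FunctionField Affine.CoordinateRing

instance {k K : Type*} [Field k] [Field K] [Algebra k K] (E : WeierstrassCurve k) [E.IsElliptic] :
    WeierstrassCurve.IsElliptic (E.baseChange K).toAffine :=
  inferInstanceAs (E.map (algebraMap k K)).IsElliptic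

lemma _root_.MvPolynomial.eval_aeval_eq_eval {σ τ R : Type*} [CommRing R] (v : τ → R)
    (F : σ → MvPolynomial τ R) (p : MvPolynomial σ R) :
    MvPolynomial.eval v (MvPolynomial.aeval F p) =
      MvPolynomial.eval (fun i => MvPolynomial.eval v (F i)) p := by
  simp only [← MvPolynomial.coe_aeval_eq_eval, RingHom.coe_coe]
  rw [← AlgHom.comp_apply, MvPolynomial.comp_aeval]

lemma Projective.isHomogeneous_polynomial {R : Type*} [CommRing R] (W : Projective R) :
    W.polynomial.IsHomogeneous 3 := by
  have h (c : R) (i j k : Fin 3) :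
      (MvPolynomial.C c * MvPolynomial.X i * MvPolynomial.X j *
        MvPolynomial.X k).IsHomogeneous 3 := by
    simpa using (((MvPolynomial.isHomogeneous_C (Fin 3) c).mul
      (MvPolynomial.isHomogeneous_X R i)).mul (MvPolynomial.isHomogeneous_X R j)).mul
      (MvPolynomial.isHomogeneous_X R k)
  have e : W.polynomial = MvPolynomial.C 1 * MvPolynomial.X 1 * MvPolynomial.X 1 * MvPolynomial.X 2
      + MvPolynomial.C W.a₁ * MvPolynomial.X 0 * MvPolynomial.X 1 * MvPolynomial.X 2
      + MvPolynomial.C W.a₃ * MvPolynomial.X 1 * MvPolynomial.X 2 * MvPolynomial.X 2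
      - (MvPolynomial.C 1 * MvPolynomial.X 0 * MvPolynomial.X 0 * MvPolynomial.X 0
      + MvPolynomial.C W.a₂ * MvPolynomial.X 0 * MvPolynomial.X 0 * MvPolynomial.X 2
      + MvPolynomial.C W.a₄ * MvPolynomial.X 0 * MvPolynomial.X 2 * MvPolynomial.X 2
      + MvPolynomial.C W.a₆ * MvPolynomial.X 2 * MvPolynomial.X 2 * MvPolynomial.X 2) := by
    rw [Projective.polynomial, map_one]
    ring
  rw [e]
  exact (((h _ _ _ _).add (h _ _ _ _)).add (h _ _ _ _)).sub
    ((((h _ _ _ _).add (h _ _ _ _)).add (h _ _ _ _)).add (h _ _ _ _))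

section Generic

variable {k K : Type*} [Field k] [Field K] [Algebra k K] (E : WeierstrassCurve k)
  (L : Type*) [Field L] [Algebra K L] [Algebra (E.baseChange K).toAffine.CoordinateRing L]

/-- The value in the function field of a polynomial in the homogeneous coordinates. -/
noncomputable def genVal : MvPolynomial (Fin 3) K →ₐ[K] L :=
  MvPolynomial.aeval ![genX (E.baseChange K).toAffine L, genY (E.baseChange K).toAffine L, 1]

variable {E L} in
lemma genVal_aeval (F : Fin 3 → MvPolynomial (Fin 3) K) (p : MvPolynomial (Fin 3) K) :
    genVal E L (MvPolynomial.aeval F p) =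
      MvPolynomial.eval (fun i => genVal E L (F i))
        (MvPolynomial.map ((Algebra.ofId K L : K →ₐ[K] L) : K →+* L) p) := by
  rw [← AlgHom.comp_apply, MvPolynomial.comp_aeval, MvPolynomial.eval_map,
    MvPolynomial.aeval_def]
  rfl

variable [IsScalarTower K (E.baseChange K).toAffine.CoordinateRing L]

lemma algebraMap_gen_eq_genVal (G : MvPolynomial (Fin 3) K) :
    algebraMap _ L (gen (E.baseChange K).toAffine G) = genVal E L G :=
  algebraMap_gen _ _ _

variable [IsFractionRing (E.baseChange K).toAffine.CoordinateRing L]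

lemma genVal_eq_zero_iff_gen {G : MvPolynomial (Fin 3) K} :
    genVal E L G = 0 ↔ gen (E.baseChange K).toAffine G = 0 := by
  rw [← algebraMap_gen_eq_genVal]
  exact map_eq_zero_iff _ (IsFractionRing.injective _ L)

variable {E L} [IsAlgClosed K]

/-- With its converse `genVal_eq_zero`, this moves polynomial identities between the generic point
and closed points. Homogeneity matters only at infinity, where pole orders replace evaluation. -/
lemma eval_coords_eq_zero {G : MvPolynomial (Fin 3) K} {n : ℕ} (hG : G.IsHomogeneous n)
    (h : genVal E L G = 0) (P : (E.baseChange K).toAffine.Point) :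
    MvPolynomial.eval (coords P) G = 0 := by
  rw [genVal_eq_zero_iff_gen] at h
  rcases P with _ | ⟨x, y, hP⟩
  · exact eval_infinity_eq_zero hG h
  · exact (gen_eq_zero_iff G).1 h x y hP.1

lemma genVal_eq_zero [E.IsElliptic] {G : MvPolynomial (Fin 3) K}
    (h : ∀ P : (E.baseChange K).toAffine.Point, MvPolynomial.eval (coords P) G = 0) :
    genVal E L G = 0 := by
  rw [genVal_eq_zero_iff_gen, gen_eq_zero_iff]
  exact fun a b hab => h (Point.mk hab)

end Generic

section Morphism

variable {k K : Type*} [Field k] [Field K] [Algebra k K] {E E' : WeierstrassCurve k}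

/-- The homogeneous polynomials `F` of degree `n` describe the map `φ` where they do not all
vanish. -/
def Describes (n : ℕ) (F : Fin 3 → MvPolynomial (Fin 3) K)
    (φ : (E.baseChange K).toAffine.Point → (E'.baseChange K).toAffine.Point) : Prop :=
  (∀ i, (F i).IsHomogeneous n) ∧
    ∀ Q, (∃ i, MvPolynomial.eval (coords Q) (F i) ≠ 0) →
      Represents (fun i => MvPolynomial.eval (coords Q) (F i)) (φ Q)

/-- A map on points is a morphism if it is described by homogeneous polynomials around every
point. -/
def IsMorphism (φ : (E.baseChange K).toAffine.Point → (E'.baseChange K).toAffine.Point) : Prop :=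
  ∀ P : (E.baseChange K).toAffine.Point, ∃ n F, Describes n F φ ∧
    ∃ i, MvPolynomial.eval (coords P) (F i) ≠ 0

variable [IsAlgClosed K] [E.IsElliptic] [E'.IsElliptic]
  {L : Type*} [Field L] [Algebra K L] [Algebra (E.baseChange K).toAffine.CoordinateRing L]
  [IsFractionRing (E.baseChange K).toAffine.CoordinateRing L]
  [IsScalarTower K (E.baseChange K).toAffine.CoordinateRing L]
  [Algebra k L] [IsScalarTower k K L]
  {φ : (E.baseChange K).toAffine.Point → (E'.baseChange K).toAffine.Point}

variable (L) in
omit [E.IsElliptic] [E'.IsElliptic] [Algebra k L] [IsScalarTower k K L] in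
lemma Describes.genVal_ne_zero {n : ℕ} {F : Fin 3 → MvPolynomial (Fin 3) K}
    (hF : Describes n F φ) {P : (E.baseChange K).toAffine.Point}
    (hP : ∃ i, MvPolynomial.eval (coords P) (F i) ≠ 0) : ∃ i, genVal E L (F i) ≠ 0 := by
  obtain ⟨i, hi⟩ := hP
  exact ⟨i, fun h => hi (eval_coords_eq_zero (hF.1 i) h P)⟩

variable (φ L) in
/-- The point `Φ` of `E'` over the function field of `E` is the generic value of the map `φ`. -/
def IsGenericValue (Φ : (E'.baseChange L).toAffine.Point) : Prop :=
  ∀ n F, Describes n F φ → (∃ i, genVal E L (F i) ≠ 0) →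
    Represents (fun i => genVal E L (F i)) Φ

/-- Any local description of `φ` defines `Φ`. The curve equation for `Φ` and the agreement with
other descriptions are polynomial identities that hold at every closed point, trivially at points
where a description vanishes. -/
lemma exists_isGenericValue (hφ : IsMorphism φ) :
    ∃ Φ : (E'.baseChange L).toAffine.Point, IsGenericValue L φ Φ := by
  obtain ⟨n, F, hF, hF0⟩ := hφ 0
  have hFL := hF.genVal_ne_zero L hF0
  have heq : (E'.baseChange L).toProjective.Equation (fun i => genVal E L (F i)) := by
    have h : genVal E L (MvPolynomial.aeval F (E'.baseChange K).toProjective.polynomial) = 0 := by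
      refine genVal_eq_zero fun P => ?_
      rw [MvPolynomial.eval_aeval_eq_eval]
      by_cases hP : ∃ i, MvPolynomial.eval (coords P) (F i) ≠ 0
      · exact (represents_iff.1 (hF.2 P hP)).1.1
      · push Not at hP
        rw [Projective.eval_polynomial]
        simp [hP]
    rwa [genVal_aeval, ← Projective.baseChange_polynomial] at h
  obtain ⟨Φ, hΦ⟩ := exists_represents hFL heq
  refine ⟨Φ, fun m G hG hGL => hΦ.of_cross_eq hGL fun i j => ?_⟩
  rw [← map_mul, ← map_mul, ← sub_eq_zero, ← map_sub]
  refine genVal_eq_zero fun P => ?_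
  rw [map_sub, map_mul, map_mul, sub_eq_zero]
  by_cases hFP : ∃ i, MvPolynomial.eval (coords P) (F i) ≠ 0
  · by_cases hGP : ∃ i, MvPolynomial.eval (coords P) (G i) ≠ 0
    · exact (hF.2 P hFP).cross_eq (hG.2 P hGP) i j
    · push Not at hGP
      rw [hGP, hGP, mul_zero, mul_zero]
  · push Not at hFP
    rw [hFP, hFP, zero_mul, zero_mul]

omit [E.IsElliptic] [E'.IsElliptic] in
/-- If the generic value of a morphism is a constant point, then the morphism is constant. -/
lemma IsGenericValue.eq_of_constant [DecidableEq K] [DecidableEq L]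
    {R : (E'.baseChange K).toAffine.Point}
    (h : IsGenericValue L φ (Point.baseChange K L R)) (hφ : IsMorphism φ)
    (P : (E.baseChange K).toAffine.Point) : φ P = R := by
  obtain ⟨n, F, hF, hFP⟩ := hφ P
  refine eq_of_cross_eq (hF.2 P hFP) (represents_coords R) fun i j => ?_
  have h1 := (h n F hF (hF.genVal_ne_zero L hFP)).cross_eq
    ((represents_coords R).map (Algebra.ofId K L)) i j
  have h2 : genVal E L
      (F i * MvPolynomial.C (coords R j) - F j * MvPolynomial.C (coords R i)) = 0 := by
    have hC (c : K) : genVal E L (MvPolynomial.C c) = Algebra.ofId K L c := by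
      simp [genVal, Algebra.ofId_apply]
    rw [map_sub, map_mul, map_mul, hC, hC, h1, sub_self]
  have h3 := eval_coords_eq_zero (n := n) ?_ h2 P
  · simpa [sub_eq_zero] using h3
  · have hc (c : K) := MvPolynomial.isHomogeneous_C (Fin 3) c
    simpa using ((hF.1 i).mul (hc _)).sub ((hF.1 j).mul (hc _))

end Morphism

end WeierstrassCurve

/-! ### The pullback of the invariant differential is a constant multiple -/

namespace WeierstrassCurve

open WeierstrassCurve.Affine Affine.Point Affine.FunctionField Affine.CoordinateRing

namespace Projective

variable {R : Type*} [CommRing R] (W : Projective R)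

lemma isHomogeneous_polynomialX : W.polynomialX.IsHomogeneous 2 :=
  W.isHomogeneous_polynomial.pderiv

lemma isHomogeneous_polynomialY : W.polynomialY.IsHomogeneous 2 :=
  W.isHomogeneous_polynomial.pderiv

lemma isHomogeneous_polynomialZ : W.polynomialZ.IsHomogeneous 2 :=
  W.isHomogeneous_polynomial.pderiv

/-- The derivative of a polynomial along the tangent vector field `W_Y ∂/∂X - W_X ∂/∂Y`. -/
noncomputable def tangent (G : MvPolynomial (Fin 3) R) : MvPolynomial (Fin 3) R :=
  MvPolynomial.pderiv 0 G * W.polynomialY - MvPolynomial.pderiv 1 G * W.polynomialX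

/-- The derivative of a polynomial along the tangent vector field `W_X ∂/∂Z - W_Z ∂/∂X`. -/
noncomputable def tangentInfinity (G : MvPolynomial (Fin 3) R) : MvPolynomial (Fin 3) R :=
  MvPolynomial.pderiv 2 G * W.polynomialX - MvPolynomial.pderiv 0 G * W.polynomialZ

lemma isHomogeneous_cross_tangentInfinity {n : ℕ} {G H : MvPolynomial (Fin 3) R}
    (hG : G.IsHomogeneous n) (hH : H.IsHomogeneous n) :
    (W.tangentInfinity G * H - G * W.tangentInfinity H).IsHomogeneous (1 + n * 2) := by
  -- Degree 0 is separate because `n - 1` is truncated; there all derivatives vanish.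
  rcases n with _ | n
  · have h {G : MvPolynomial (Fin 3) R} (hG : G.IsHomogeneous 0) : W.tangentInfinity G = 0 := by
      rw [tangentInfinity, MvPolynomial.totalDegree_eq_zero_iff_eq_C.1
        ((MvPolynomial.totalDegree_zero_iff_isHomogeneous _).2 hG)]
      simp
    rw [h hG, h hH, zero_mul, mul_zero, sub_zero]
    exact MvPolynomial.isHomogeneous_zero _ _ _
  · have h {G : MvPolynomial (Fin 3) R} (hG : G.IsHomogeneous (n + 1)) :
        (W.tangentInfinity G).IsHomogeneous (n + 2) :=
      (hG.pderiv.mul W.isHomogeneous_polynomialX).sub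
        (hG.pderiv.mul W.isHomogeneous_polynomialZ)
    have e : 1 + (n + 1) * 2 = n + 2 + (n + 1) := by ring
    rw [e]
    refine ((h hG).mul hH).sub ?_
    rw [add_comm]
    exact hG.mul (h hH)

end Projective

section LogDeriv

variable {k K : Type*} [Field k] [Field K] [Algebra k K] {E E' : WeierstrassCurve k}
  {L : Type*} [Field L] [Algebra K L] [Algebra (E.baseChange K).toAffine.CoordinateRing L]
  [IsScalarTower K (E.baseChange K).toAffine.CoordinateRing L]

omit [IsScalarTower K (E.baseChange K).toAffine.CoordinateRing L] in
lemma genVal_X_zero : genVal E L (MvPolynomial.X 0 : MvPolynomial (Fin 3) K) =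
    Affine.FunctionField.genX (E.baseChange K).toAffine L := by
  simp [genVal]

omit [IsScalarTower K (E.baseChange K).toAffine.CoordinateRing L] in
lemma genVal_X_one : genVal E L (MvPolynomial.X 1 : MvPolynomial (Fin 3) K) =
    Affine.FunctionField.genY (E.baseChange K).toAffine L := by
  simp [genVal]

omit [IsScalarTower K (E.baseChange K).toAffine.CoordinateRing L] in
lemma genVal_X_two : genVal E L (MvPolynomial.X 2 : MvPolynomial (Fin 3) K) = 1 := by
  simp [genVal]

omit [IsScalarTower K (E.baseChange K).toAffine.CoordinateRing L] in
lemma derivation_genVal (D : Derivation K L L) (G : MvPolynomial (Fin 3) K) :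
    D (genVal E L G) =
      genVal E L (MvPolynomial.pderiv 0 G) * D (genX (E.baseChange K).toAffine L) +
      genVal E L (MvPolynomial.pderiv 1 G) * D (genY (E.baseChange K).toAffine L) := by
  induction G using MvPolynomial.induction_on with
  | C c => simp [genVal]
  | add p q hp hq =>
    simp only [map_add, hp, hq]
    ring
  | mul_X p i hp =>
    simp only [map_mul, Derivation.leibniz, smul_eq_mul, hp, map_add]
    fin_cases i <;> simp [genVal, MvPolynomial.pderiv_X] <;> ring

variable (E L) in
/-- The derivation of the function field that is dual to the invariant differential. -/
structure IsInvariantDerivation (D : Derivation K L L) : Prop where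
  genX : D (genX (E.baseChange K).toAffine L) =
    genVal E L (E.baseChange K).toProjective.polynomialY
  genY : D (genY (E.baseChange K).toAffine L) =
    -genVal E L (E.baseChange K).toProjective.polynomialX

variable {D : Derivation K L L} (hD : IsInvariantDerivation E L D)
include hD

omit [IsScalarTower K (E.baseChange K).toAffine.CoordinateRing L] in
lemma IsInvariantDerivation.apply_genVal (G : MvPolynomial (Fin 3) K) :
    D (genVal E L G) = genVal E L ((E.baseChange K).toProjective.tangent G) := by
  rw [derivation_genVal, hD.genX, hD.genY, Projective.tangent, map_sub, map_mul, map_mul]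
  ring

/-- This changes from the chart `Z = 1` to the chart `Y = 1`, using Euler's relations for `G` and
for the cubic. The correction term proportional to `G` cancels in `D F_i * F_j - F_i * D F_j`. -/
lemma IsInvariantDerivation.genY_mul_apply_genVal {n : ℕ} {G : MvPolynomial (Fin 3) K}
    (hG : G.IsHomogeneous n) :
    Affine.FunctionField.genY (E.baseChange K).toAffine L * D (genVal E L G) =
      genVal E L ((E.baseChange K).toProjective.tangentInfinity G) -
        n * genVal E L (E.baseChange K).toProjective.polynomialX * genVal E L G := by
  have euler := congrArg (genVal E L) hG.sum_X_mul_pderiv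
  have rel := congrArg (genVal E L)
    ((E.baseChange K).toProjective.isHomogeneous_polynomial.sum_X_mul_pderiv)
  have eqn : genVal E L (E.baseChange K).toProjective.polynomial = 0 := by
    have h := gen_equation (E.baseChange K).toAffine L
    simp only [genVal, Projective.polynomial, map_sub, map_add, map_mul, map_pow,
      MvPolynomial.aeval_X, MvPolynomial.aeval_C, Matrix.cons_val]
    linear_combination h
  rw [derivation_genVal, hD.genX, hD.genY, Projective.tangentInfinity]
  simp only [Fin.sum_univ_three, map_add, map_mul, map_sub, map_natCast, eqn,
    nsmul_eq_mul, mul_zero] at euler rel ⊢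
  change _ * genVal E L (E.baseChange K).toProjective.polynomialX +
    _ * genVal E L (E.baseChange K).toProjective.polynomialY +
    _ * genVal E L (E.baseChange K).toProjective.polynomialZ = _ at rel
  rw [genVal_X_zero, genVal_X_one, genVal_X_two] at euler rel
  linear_combination genVal E L (MvPolynomial.pderiv 0 G) * rel -
    genVal E L (E.baseChange K).toProjective.polynomialX * euler

omit hD in
/-- Over an algebraically closed field of constants, the logarithmic derivative of the generic value
of a morphism is a constant. -/
theorem IsGenericValue.exists_isLogDeriv [IsAlgClosed K] [CharZero K] [E.IsElliptic]
    [E'.IsElliptic] [IsFractionRing (E.baseChange K).toAffine.CoordinateRing L]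
    [Algebra k L] [IsScalarTower k K L]
    (hD : IsInvariantDerivation E L D)
    {φ : (E.baseChange K).toAffine.Point → (E'.baseChange K).toAffine.Point} (hφ : IsMorphism φ)
    {Φ : (E'.baseChange L).toAffine.Point} (hΦ : IsGenericValue L φ Φ) {d : L}
    (hd : IsLogDeriv D Φ d) : ∃ c : K, d = algebraMap K L c := by
  -- Nonsingularity of `E'` at `φ P` supplies a partial derivative `p` that does not vanish at
  -- `F(P)`; it serves as the denominator of `d` near `P`.
  have key (P : (E.baseChange K).toAffine.Point) : ∃ n : ℕ, ∃ F : Fin 3 → MvPolynomial (Fin 3) K,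
      (∀ i, (F i).IsHomogeneous n) ∧ ∃ (i j : Fin 3) (p : MvPolynomial (Fin 3) K),
        p.IsHomogeneous 2 ∧ MvPolynomial.eval (coords P) (MvPolynomial.aeval F p) ≠ 0 ∧
        d * genVal E L (MvPolynomial.aeval F p) =
          D (genVal E L (F i)) * genVal E L (F j) - genVal E L (F i) * D (genVal E L (F j)) := by
    obtain ⟨n, F, hF, hFP⟩ := hφ P
    refine ⟨n, F, hF.1, ?_⟩
    have hns := ((represents_iff.1 (hF.2 P hFP)).1).2
    obtain ⟨hY, hX, hZ⟩ := (hΦ n F hF (hF.genVal_ne_zero L hFP)).derivation_cross hd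
    simp only [← MvPolynomial.eval_aeval_eq_eval] at hns
    rcases hns with h | h | h
    · refine ⟨2, 1, _, Projective.isHomogeneous_polynomialX _, h, ?_⟩
      rw [genVal_aeval, ← Projective.baseChange_polynomialX, ← hX]
      ring
    · refine ⟨0, 2, _, Projective.isHomogeneous_polynomialY _, h, ?_⟩
      rw [genVal_aeval, ← Projective.baseChange_polynomialY, ← hY]
    · refine ⟨1, 0, _, Projective.isHomogeneous_polynomialZ _, h, ?_⟩
      rw [genVal_aeval, ← Projective.baseChange_polynomialZ, ← hZ]
      ring
  suffices h : ∃ c, d = algebraMap (E.baseChange K).toAffine.CoordinateRing L (algebraMap K _ c) by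
    simpa only [← IsScalarTower.algebraMap_apply] using h
  refine eq_algebraMap_of_regular (fun a b hab => ?_) ?_
  · obtain ⟨n, F, hF, i, j, p, -, h0, h⟩ := key (Point.mk hab)
    refine ⟨(E.baseChange K).toProjective.tangent (F i) * F j -
      F i * (E.baseChange K).toProjective.tangent (F j), _, h0, ?_⟩
    rw [algebraMap_gen_eq_genVal, h, hD.apply_genVal, hD.apply_genVal, ← map_mul, ← map_mul,
      ← map_sub, algebraMap_gen_eq_genVal]
  -- At infinity numerator and denominator must have equal degree. The denominator `p(F)` has degree
  -- `2n` and the numerator `2n + 1`, so the denominator is multiplied by `Y`, which is nonzero at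
  -- `[0 : 1 : 0]`.
  · obtain ⟨n, F, hF, i, j, p, hp, h0, h⟩ := key 0
    refine ⟨1 + n * 2, _, MvPolynomial.X 1 * MvPolynomial.aeval F p,
      (E.baseChange K).toProjective.isHomogeneous_cross_tangentInfinity (hF i) (hF j),
      (MvPolynomial.isHomogeneous_X K 1).mul (hp.aeval F hF), ?_, ?_⟩
    · rw [map_mul]
      refine mul_ne_zero (by simp) h0
    · rw [algebraMap_gen_eq_genVal, algebraMap_gen_eq_genVal, map_mul, map_sub, map_mul, map_mul]
      have hi := hD.genY_mul_apply_genVal (hF i)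
      have hj := hD.genY_mul_apply_genVal (hF j)
      rw [genVal_X_one]
      linear_combination Affine.FunctionField.genY (E.baseChange K).toAffine L * h +
        genVal E L (F j) * hi -
        genVal E L (F i) * hj

end LogDeriv

end WeierstrassCurve

/-! ### Constant points and translations of the function field -/

namespace WeierstrassCurve

open WeierstrassCurve.Affine Affine.Point Affine.FunctionField Affine.CoordinateRing

section Constant

variable {k K : Type*} [Field k] [Field K] [Algebra k K] {E' : WeierstrassCurve k}
  {L : Type*} [Field L] [Algebra K L] [Algebra k L] [IsScalarTower k K L]

lemma isHorizontal_baseChange (D : Derivation K L L) :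
    Affine.IsHorizontal D (E'.baseChange L).toAffine := by
  have h (c : k) : D (algebraMap k L c) = 0 := by
    rw [IsScalarTower.algebraMap_apply k K L]
    exact D.map_algebraMap _
  exact ⟨h _, h _, h _, h _, h _⟩

lemma exists_algebraMap_eq_of_isAlgebraic [IsAlgClosed K] {x : L} (hx : IsAlgebraic K x) :
    ∃ c : K, algebraMap K L c = x := by
  obtain ⟨c, hc⟩ := (IsAlgClosed.algebraMap_bijective_of_isIntegral (k := K)
    (K := integralClosure K L)).2 ⟨x, hx.isIntegral⟩
  exact ⟨c, congrArg Subtype.val hc⟩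

variable [DecidableEq K] [DecidableEq L]

lemma exists_baseChange_eq {x y : L} (h : (E'.baseChange L).toAffine.Nonsingular x y) {a b : K}
    (ha : algebraMap K L a = x) (hb : algebraMap K L b = y) :
    ∃ S : (E'.baseChange K).toAffine.Point, Point.baseChange K L S = .some x y h := by
  subst ha hb
  exact ⟨.some a b ((Affine.baseChange_nonsingular E' (f := Algebra.ofId K L)
    (Algebra.ofId K L).injective a b).1 h), rfl⟩

/-- A point with algebraic first coordinate is a constant point. -/
lemma exists_baseChange_eq_of_isAlgebraic [IsAlgClosed K] {x y : L}
    (h : (E'.baseChange L).toAffine.Nonsingular x y) (hx : IsAlgebraic K x) :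
    ∃ S : (E'.baseChange K).toAffine.Point, Point.baseChange K L S = .some x y h := by
  obtain ⟨a, rfl⟩ := exists_algebraMap_eq_of_isAlgebraic hx
  have e := ((Affine.equation_iff _ _).1 h.1)
  have hy : _root_.IsIntegral K y := by
    set W := (E'.baseChange K).toAffine
    refine ⟨Polynomial.X ^ 2 + Polynomial.C (W.a₁ * a + W.a₃) * Polynomial.X -
      Polynomial.C (a ^ 3 + W.a₂ * a ^ 2 + W.a₄ * a + W.a₆), by monicity!, ?_⟩
    have hc (c : k) : algebraMap k L c = algebraMap K L (algebraMap k K c) :=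
      IsScalarTower.algebraMap_apply k K L c
    simp only [WeierstrassCurve.baseChange, WeierstrassCurve.map, hc] at e
    simp only [Polynomial.eval₂_sub, Polynomial.eval₂_add, Polynomial.eval₂_mul,
      Polynomial.eval₂_pow, Polynomial.eval₂_X, Polynomial.eval₂_C, map_add, map_mul, map_pow, W,
      WeierstrassCurve.baseChange, WeierstrassCurve.map]
    linear_combination e
  obtain ⟨b, hb⟩ := exists_algebraMap_eq_of_isAlgebraic hy.isAlgebraic
  exact exists_baseChange_eq h rfl hb

lemma isLogDeriv_baseChange (D : Derivation K L L) (S : (E'.baseChange K).toAffine.Point) :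
    IsLogDeriv D (Point.baseChange K L S) 0 := by
  rcases S with _ | ⟨x, y, h⟩
  · rfl
  · simp [Point.baseChange, Point.map_some, isLogDeriv_some_iff]

omit [DecidableEq K] in
lemma isLogDeriv_map {D : Derivation K L L} {τ : L →ₐ[K] L} (hτ : ∀ z, D (τ z) = τ (D z))
    {P : (E'.baseChange L).toAffine.Point} {d : L} (hd : IsLogDeriv D P d) :
    IsLogDeriv D (Point.map τ P) (τ d) := by
  rcases P with _ | ⟨x, y, h⟩
  · exact (congrArg τ hd).trans (_root_.map_zero τ)
  · have hc (c : k) : τ (algebraMap k L c) = algebraMap k L c :=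
      (τ.restrictScalars k).commutes c
    obtain ⟨h1, h2⟩ := hd
    refine ⟨?_, ?_⟩
    · rw [hτ, h1]
      simp [hc, map_ofNat τ]
    · rw [hτ, h2]
      simp [hc, map_ofNat τ]

end Constant

section Translation

variable {k K : Type*} [Field k] [Field K] [Algebra k K] {E E' : WeierstrassCurve k}
  {L : Type*} [Field L] [Algebra K L] [Algebra (E.baseChange K).toAffine.CoordinateRing L]
  [IsScalarTower K (E.baseChange K).toAffine.CoordinateRing L]
  [IsFractionRing (E.baseChange K).toAffine.CoordinateRing L]
  [Algebra k L] [IsScalarTower k K L] [CharZero K] [IsAlgClosed K] [E.IsElliptic]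
  [DecidableEq K] [DecidableEq L]

omit [IsFractionRing (E.baseChange K).toAffine.CoordinateRing L] [CharZero K] [IsAlgClosed K]
  [E.IsElliptic] [DecidableEq K] [DecidableEq L] in
variable (E L) in
lemma genericPoint_equation : (E.baseChange L).toAffine.Equation
    (Affine.FunctionField.genX (E.baseChange K).toAffine L)
    (Affine.FunctionField.genY (E.baseChange K).toAffine L) := by
  have h := gen_equation (E.baseChange K).toAffine L
  have hc (c : k) : algebraMap k L c = algebraMap K L (algebraMap k K c) :=
    IsScalarTower.algebraMap_apply k K L c
  rw [Affine.equation_iff]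
  simp only [WeierstrassCurve.baseChange, WeierstrassCurve.map, hc]
  exact h

variable (E K L) in
/-- The generic point of an elliptic curve. -/
noncomputable def genericPoint : (E.baseChange L).toAffine.Point :=
  .mk (genericPoint_equation (K := K) E L)

omit [CharZero K] [IsAlgClosed K] [IsFractionRing (E.baseChange K).toAffine.CoordinateRing L]
  [DecidableEq K] [DecidableEq L] in
lemma isLogDeriv_genericPoint {D : Derivation K L L} (hD : IsInvariantDerivation E L D) :
    IsLogDeriv D (genericPoint K E L) 1 := by
  have hc (c : k) : algebraMap k L c = algebraMap K L (algebraMap k K c) :=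
    IsScalarTower.algebraMap_apply k K L c
  refine ⟨?_, ?_⟩
  · rw [hD.genX]
    simp [genVal, Projective.polynomialY_eq, hc, map_ofNat (algebraMap K L)]
  · rw [hD.genY]
    simp [genVal, Projective.polynomialX_eq, hc, map_ofNat (algebraMap K L)]

omit [CharZero K] [IsAlgClosed K] in
lemma genericPoint_ne_baseChange (S : (E.baseChange K).toAffine.Point) :
    genericPoint K E L ≠ Point.baseChange K L S := by
  intro h
  rcases S with _ | ⟨x, y, hS⟩
  · exact Point.some_ne_zero _ h
  · simp only [genericPoint, Point.mk, Point.baseChange, Point.map_some, Point.some.injEq] at h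
    exact transcendental_genX (E.baseChange K).toAffine L (h.1 ▸ isAlgebraic_algebraMap x)

omit [CharZero K] in
variable (L) in
/-- Translation by a point is an endomorphism of the function field. -/
theorem exists_translation (Q : (E.baseChange K).toAffine.Point) :
    ∃ τ : L →ₐ[K] L,
      Point.map τ (genericPoint K E L) = genericPoint K E L + Point.baseChange K L Q := by
  -- The translated generic point is not a constant point, so its first coordinate is
  -- transcendental, as `exists_algHom` requires.
  have hne (S : (E.baseChange K).toAffine.Point) :
      genericPoint K E L + Point.baseChange K L Q ≠ Point.baseChange K L S := by
    intro h
    refine genericPoint_ne_baseChange (L := L) (S - Q) ?_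
    rw [_root_.map_sub, ← h, add_sub_cancel_right]
  generalize genericPoint K E L + Point.baseChange K L Q = P at hne ⊢
  rcases P with _ | ⟨x, y, h⟩
  · exact absurd (_root_.map_zero _).symm (hne 0)
  · have hx : Transcendental K x := by
      intro hx
      obtain ⟨S, hS⟩ := exists_baseChange_eq_of_isAlgebraic h hx
      exact hne S hS.symm
    have hc (c : k) : algebraMap k L c = algebraMap K L (algebraMap k K c) :=
      IsScalarTower.algebraMap_apply k K L c
    have e := (Affine.equation_iff _ _).1 h.1
    simp only [WeierstrassCurve.baseChange, WeierstrassCurve.map, hc] at e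
    obtain ⟨τ, h1, h2⟩ := Affine.FunctionField.exists_algHom (W := (E.baseChange K).toAffine) hx e
    refine ⟨τ, ?_⟩
    simp only [genericPoint, Point.mk, Point.map_some, h1, h2]

omit [CharZero K] [IsAlgClosed K] [DecidableEq K] in
lemma algHom_ext_genericPoint {τ τ' : L →ₐ[K] L}
    (h : Point.map τ (genericPoint K E L) = Point.map τ' (genericPoint K E L)) : τ = τ' := by
  simp only [genericPoint, Point.mk, Point.map_some, Point.some.injEq] at h
  exact algHom_ext_gen h.1 h.2

omit [IsAlgClosed K] in
/-- The invariant derivation commutes with translations. -/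
lemma IsInvariantDerivation.comm {D : Derivation K L L} (hD : IsInvariantDerivation E L D)
    {Q : (E.baseChange K).toAffine.Point} {τ : L →ₐ[K] L}
    (hτ : Point.map τ (genericPoint K E L) = genericPoint K E L + Point.baseChange K L Q) (z : L) :
    D (τ z) = τ (D z) := by
  have : CharZero L := charZero_of_injective_algebraMap (algebraMap K L).injective
  -- The translated generic point has logarithmic derivative `1 + 0`. Spelled out on coordinates,
  -- this is the commutation of `D` and `τ` on the generators.
  have h := (isLogDeriv_genericPoint hD).add (isHorizontal_baseChange D)
    (isLogDeriv_baseChange (E' := E) D Q)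
  rw [← hτ, add_zero] at h
  have h0 := isLogDeriv_genericPoint hD
  have hc (c : k) : τ (algebraMap k L c) = algebraMap k L c :=
    (τ.restrictScalars k).commutes c
  obtain ⟨h1, h2⟩ := h
  obtain ⟨h3, h4⟩ := h0
  refine derivation_comm (W := (E.baseChange K).toAffine) D τ ?_ ?_ z
  · rw [h3]
    refine h1.trans ?_
    simp [hc, map_ofNat τ]
  · rw [h4]
    refine h2.trans ?_
    simp [hc, map_ofNat τ]

/-- A translation changes the generic value of a morphism by a constant point. -/
theorem IsGenericValue.exists_map_translation [E'.IsElliptic]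
    {φ : (E.baseChange K).toAffine.Point → (E'.baseChange K).toAffine.Point} (hφ : IsMorphism φ)
    {Φ : (E'.baseChange L).toAffine.Point} (hΦ : IsGenericValue L φ Φ)
    {Q : (E.baseChange K).toAffine.Point} {τ : L →ₐ[K] L}
    (hτ : Point.map τ (genericPoint K E L) = genericPoint K E L + Point.baseChange K L Q) :
    ∃ R : (E'.baseChange K).toAffine.Point, Point.map τ Φ = Φ + Point.baseChange K L R := by
  have : CharZero L := charZero_of_injective_algebraMap (algebraMap K L).injective
  obtain ⟨D, hD1, hD2⟩ := exists_derivation (E.baseChange K).toAffine L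
  have hD0 : D (Affine.FunctionField.genX (E.baseChange K).toAffine L) ≠ 0 := by
    rw [hD1]
    exact two_mul_genY_ne_zero _ _
  have hD : IsInvariantDerivation E L D := by
    refine ⟨?_, ?_⟩
    · rw [hD1]
      simp [genVal, Projective.polynomialY_eq, map_ofNat (algebraMap K L)]
    · rw [hD2]
      simp [genVal, Projective.polynomialX_eq, map_ofNat (algebraMap K L)]
  have hhor := isHorizontal_baseChange (E' := E') D
  obtain ⟨d, hd⟩ := Affine.Point.exists_isLogDeriv hhor Φ
  obtain ⟨c, rfl⟩ := hΦ.exists_isLogDeriv hD hφ hd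
  -- As `c` is a constant, `τ Φ` and `Φ` have the same logarithmic derivative, so `D` kills the
  -- coordinates of their difference.
  have h1 := isLogDeriv_map (hD.comm hτ) hd
  rw [τ.commutes] at h1
  have h2 := h1.sub hhor hd
  rw [sub_self] at h2
  suffices h : ∃ R : (E'.baseChange K).toAffine.Point,
      Point.baseChange K L R = Point.map τ Φ - Φ by
    obtain ⟨R, hR⟩ := h
    exact ⟨R, by rw [hR, add_sub_cancel]⟩
  generalize Point.map τ Φ - Φ = P at h2 ⊢
  rcases P with _ | ⟨x, y, h⟩
  · exact ⟨0, _root_.map_zero _⟩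
  · obtain ⟨hx, hy⟩ := h2
    rw [zero_mul] at hx hy
    obtain ⟨a, ha⟩ := eq_algebraMap_of_derivation_eq_zero D hD0 hx
    obtain ⟨b, hb⟩ := eq_algebraMap_of_derivation_eq_zero D hD0 hy
    exact exists_baseChange_eq h ha.symm hb.symm

end Translation

end WeierstrassCurve

/-! ### Specialization at the identity, and additivity of morphisms -/

namespace WeierstrassCurve

open WeierstrassCurve.Affine Affine.Point Affine.FunctionField Affine.CoordinateRing

namespace Projective

variable {K : Type*} [Field K] (W : Projective K)

/-- The addition formula with a fixed second point, as polynomials in the coordinates of the first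
point. -/
noncomputable def addPolynomial (w : Fin 3 → K) : Fin 3 → MvPolynomial (Fin 3) K :=
  (W.map MvPolynomial.C).toProjective.addXYZ MvPolynomial.X (MvPolynomial.C ∘ w)

lemma aeval_addPolynomial {A : Type*} [CommRing A] [Algebra K A] (v : Fin 3 → A) (w : Fin 3 → K)
    (i : Fin 3) : MvPolynomial.aeval v (W.addPolynomial w i) =
      (W.map (algebraMap K A)).toProjective.addXYZ v (algebraMap K A ∘ w) i := by
  set f : MvPolynomial (Fin 3) K →+* A := (MvPolynomial.aeval v).toRingHom with hf
  have h : ((W.map MvPolynomial.C).map f).toProjective.addXYZ (f ∘ MvPolynomial.X)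
      (f ∘ MvPolynomial.C ∘ w) i = f (W.addPolynomial w i) :=
    congrFun (map_addXYZ f _ _) i
  have hC : f.comp MvPolynomial.C = algebraMap K A := by
    ext c
    simp [f]
  have h1 : f ∘ MvPolynomial.X = v := by
    ext i
    simp [f]
  have h2 : f ∘ MvPolynomial.C ∘ w = algebraMap K A ∘ w := by
    ext i
    simp [f]
  have hW : (W.map MvPolynomial.C).map f = W.map (algebraMap K A) :=
    (WeierstrassCurve.map_map W _ _).trans (congrArg W.map hC)
  rw [hW, h1, h2] at h
  exact h.symm

/-- The addition formula is a quadratic form in the first point. The coefficients supplied in the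
next three lemmas are those of the formula, collected by monomials in that point. -/
lemma isHomogeneous_quadraticForm (c₁ c₂ c₃ c₄ c₅ c₆ : K) :
    (MvPolynomial.C c₁ * MvPolynomial.X 0 * MvPolynomial.X 0
      + MvPolynomial.C c₂ * MvPolynomial.X 1 * MvPolynomial.X 1
      + MvPolynomial.C c₃ * MvPolynomial.X 2 * MvPolynomial.X 2
      + MvPolynomial.C c₄ * MvPolynomial.X 0 * MvPolynomial.X 1
      + MvPolynomial.C c₅ * MvPolynomial.X 0 * MvPolynomial.X 2
      + MvPolynomial.C c₆ * MvPolynomial.X 1 * MvPolynomial.X 2 :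
        MvPolynomial (Fin 3) K).IsHomogeneous 2 := by
  have hq (c : K) (i j : Fin 3) :
      (MvPolynomial.C c * MvPolynomial.X i * MvPolynomial.X j).IsHomogeneous 2 := by
    simpa using ((MvPolynomial.isHomogeneous_C (Fin 3) c).mul
      (MvPolynomial.isHomogeneous_X K i)).mul (MvPolynomial.isHomogeneous_X K j)
  exact (((((hq _ _ _).add (hq _ _ _)).add (hq _ _ _)).add (hq _ _ _)).add (hq _ _ _)).add
    (hq _ _ _)

lemma isHomogeneous_addX (w : Fin 3 → K) : ((W.map MvPolynomial.C).toProjective.addX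
    MvPolynomial.X (MvPolynomial.C ∘ w) : MvPolynomial (Fin 3) K).IsHomogeneous 2 := by
  have h := isHomogeneous_quadraticForm (-W.a₁ * w 1 * w 2 + W.a₂ * w 0 * w 2 + W.a₄ * w 2 ^ 2)
    (w 0 * w 2) (W.a₃ * w 0 * w 1 - W.a₄ * w 0 ^ 2 - 3 * W.a₆ * w 0 * w 2)
    (-2 * w 1 * w 2 - W.a₃ * w 2 ^ 2)
    (-w 1 ^ 2 - W.a₂ * w 0 ^ 2 - 2 * W.a₃ * w 1 * w 2 + 3 * W.a₆ * w 2 ^ 2)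
    (2 * w 0 * w 1 + W.a₁ * w 0 ^ 2 + 2 * W.a₃ * w 0 * w 2)
  simp only [map_add, map_sub, map_neg, map_mul, map_pow, map_ofNat] at h
  refine Eq.mp (congrArg (MvPolynomial.IsHomogeneous · 2) ?_) h
  simp only [addX, Function.comp_apply, map_a₁, map_a₂, map_a₃, map_a₄, map_a₆]
  ring

lemma isHomogeneous_addZ (w : Fin 3 → K) : ((W.map MvPolynomial.C).toProjective.addZ
    MvPolynomial.X (MvPolynomial.C ∘ w) : MvPolynomial (Fin 3) K).IsHomogeneous 2 := by
  have h := isHomogeneous_quadraticForm (-3 * w 0 * w 2 - W.a₂ * w 2 ^ 2) (w 2 ^ 2)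
    (-w 1 ^ 2 - W.a₁ * w 0 * w 1 + W.a₂ * w 0 ^ 2 - W.a₃ * w 1 * w 2 + W.a₄ * w 0 * w 2)
    (W.a₁ * w 2 ^ 2) (3 * w 0 ^ 2 - W.a₄ * w 2 ^ 2) (W.a₃ * w 2 ^ 2)
  simp only [map_add, map_sub, map_neg, map_mul, map_pow, map_ofNat] at h
  refine Eq.mp (congrArg (MvPolynomial.IsHomogeneous · 2) ?_) h
  simp only [addZ, Function.comp_apply, map_a₁, map_a₂, map_a₃, map_a₄]
  ring

lemma isHomogeneous_negAddY (w : Fin 3 → K) : ((W.map MvPolynomial.C).toProjective.negAddY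
    MvPolynomial.X (MvPolynomial.C ∘ w) : MvPolynomial (Fin 3) K).IsHomogeneous 2 := by
  have h := isHomogeneous_quadraticForm (-3 * w 0 * w 1 - W.a₂ * w 1 * w 2)
    (-w 1 * w 2 - W.a₁ * w 0 * w 2 - W.a₃ * w 2 ^ 2)
    (W.a₃ * w 1 ^ 2 - W.a₄ * w 0 * w 1 - 3 * W.a₆ * w 1 * w 2)
    (3 * w 0 ^ 2 + 2 * W.a₂ * w 0 * w 2 + W.a₄ * w 2 ^ 2)
    (W.a₁ * w 1 ^ 2 - 2 * W.a₂ * w 0 * w 1 - 2 * W.a₄ * w 1 * w 2)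
    (w 1 ^ 2 + W.a₂ * w 0 ^ 2 + 2 * W.a₄ * w 0 * w 2 + 3 * W.a₆ * w 2 ^ 2)
  simp only [map_add, map_sub, map_neg, map_mul, map_pow, map_ofNat] at h
  refine Eq.mp (congrArg (MvPolynomial.IsHomogeneous · 2) ?_) h
  simp only [negAddY, Function.comp_apply, map_a₁, map_a₂, map_a₃, map_a₄, map_a₆]
  ring

lemma isHomogeneous_addPolynomial (w : Fin 3 → K) (i : Fin 3) :
    (W.addPolynomial w i).IsHomogeneous 2 := by
  have hc {G : MvPolynomial (Fin 3) K} (c : K) (hG : G.IsHomogeneous 2) :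
      (MvPolynomial.C c * G).IsHomogeneous 2 := by
    simpa using (MvPolynomial.isHomogeneous_C (Fin 3) c).mul hG
  rw [addPolynomial]
  fin_cases i
  · exact (addXYZ_X (W' := (W.map MvPolynomial.C).toProjective) _ _).symm ▸ W.isHomogeneous_addX w
  · refine (addXYZ_Y (W' := (W.map MvPolynomial.C).toProjective) _ _).symm ▸ ?_
    rw [addY, negY_eq]
    exact ((W.isHomogeneous_negAddY w).neg.sub (hc W.a₁ (W.isHomogeneous_addX w))).sub
      (hc W.a₃ (W.isHomogeneous_addZ w))
  · exact (addXYZ_Z (W' := (W.map MvPolynomial.C).toProjective) _ _).symm ▸ W.isHomogeneous_addZ w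

end Projective

section Additive

variable {k K : Type*} [Field k] [Field K] [Algebra k K] {E E' : WeierstrassCurve k}
  {L : Type*} [Field L] [Algebra K L] [Algebra (E.baseChange K).toAffine.CoordinateRing L]
  [IsScalarTower K (E.baseChange K).toAffine.CoordinateRing L]
  [IsFractionRing (E.baseChange K).toAffine.CoordinateRing L]
  [Algebra k L] [IsScalarTower k K L] [CharZero K] [IsAlgClosed K] [E.IsElliptic]
  [DecidableEq K] [DecidableEq L]

omit [CharZero K] [IsAlgClosed K] [DecidableEq K] [DecidableEq L] in
lemma map_baseChange_algebraMap (E : WeierstrassCurve k) :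
    (E.baseChange K).map (algebraMap K L) = E.baseChange L := by
  rw [WeierstrassCurve.baseChange, WeierstrassCurve.map_map, ← IsScalarTower.algebraMap_eq]
  rfl

omit [Field L] in
lemma eval_smul_of_isHomogeneous {A : Type*} [CommRing A] {n : ℕ} {F : MvPolynomial (Fin 3) A}
    (hF : F.IsHomogeneous n) (c : A) (v : Fin 3 → A) :
    MvPolynomial.eval (fun i => c * v i) F = c ^ n * MvPolynomial.eval v F := by
  rw [MvPolynomial.eval_eq', MvPolynomial.eval_eq', Finset.mul_sum]
  refine Finset.sum_congr rfl fun d hd => ?_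
  have h : ∑ i, d i = n := by
    have := hF (MvPolynomial.mem_support_iff.1 hd)
    rw [Finsupp.weight_apply, Finsupp.sum_fintype _ _ (by simp)] at this
    simpa using this
  rw [← h, ← Finset.prod_pow_eq_pow_sum, mul_left_comm, ← Finset.prod_mul_distrib]
  simp only [mul_pow]

omit [CharZero K] [IsAlgClosed K] [E.IsElliptic] in
lemma represents_addPolynomial {P Q : (E.baseChange K).toAffine.Point} (hPQ : P ≠ Q)
    {v : Fin 3 → K} (hv : Represents v P) :
    Represents (fun i => MvPolynomial.eval v
      ((E.baseChange K).toProjective.addPolynomial (coords Q) i)) (P + Q) := by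
  have h := hv.add (represents_coords Q) hPQ
  convert h using 2 with i
  rw [← MvPolynomial.coe_aeval_eq_eval, RingHom.coe_coe, Projective.aeval_addPolynomial]
  rfl

omit [CharZero K] [IsAlgClosed K] in
lemma represents_addPolynomial_baseChange {P : (E'.baseChange L).toAffine.Point}
    {Q : (E'.baseChange K).toAffine.Point} (hPQ : P ≠ Point.baseChange K L Q)
    {v : Fin 3 → L} (hv : Represents v P) :
    Represents (fun i => MvPolynomial.aeval v
      ((E'.baseChange K).toProjective.addPolynomial (coords Q) i))
      (P + Point.baseChange K L Q) := by
  have h := hv.add ((represents_coords Q).map (Algebra.ofId K L)) hPQ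
  convert h using 2 with i
  rw [Projective.aeval_addPolynomial]
  change ((E'.baseChange K).map (algebraMap K L)).toProjective.addXYZ _ _ _ = _
  rw [map_baseChange_algebraMap]
  rfl

omit [CharZero K] in
-- The relation `φ(P + Q) = φ(P) + R` holds for generic `P` and is specialized to `P = 0`.
-- Polynomials `H` represent the left side and `G` the right side, both generically and at `0`.
-- Their 2×2 minors vanish generically, hence at `0`, which gives `φ Q = R`.
theorem IsGenericValue.eq_of_map_translation [E'.IsElliptic]
    {φ : (E.baseChange K).toAffine.Point → (E'.baseChange K).toAffine.Point} (hφ : IsMorphism φ)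
    (h0 : φ 0 = 0)
    {Φ : (E'.baseChange L).toAffine.Point} (hΦ : IsGenericValue L φ Φ)
    (hne : ∀ R, Φ ≠ Point.baseChange K L R)
    {Q : (E.baseChange K).toAffine.Point} {τ : L →ₐ[K] L}
    (hτ : Point.map τ (genericPoint K E L) = genericPoint K E L + Point.baseChange K L Q)
    {R : (E'.baseChange K).toAffine.Point} (hR : Point.map τ Φ = Φ + Point.baseChange K L R) :
    φ Q = R := by
  -- The addition formula needs distinct points, so specializing `P + Q` at `P = 0` requires `Q ≠
  -- 0`. The case `R = 0` is split off below for the same reason.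
  by_cases hQ : Q = 0
  · subst hQ
    obtain rfl : τ = AlgHom.id K L := algHom_ext_genericPoint (E := E) (by
      rw [hτ, _root_.map_zero, add_zero]
      exact (Point.map_id _).symm)
    have h : Point.map (AlgHom.id K L) Φ = Φ := Point.map_id _
    rw [h, left_eq_add, ← _root_.map_zero (Point.baseChange (W' := E') K L)] at hR
    rw [h0, Point.map_injective (Algebra.ofId K L) hR]
  obtain ⟨n, F, hF, hFQ⟩ := hφ Q
  set H : Fin 3 → MvPolynomial (Fin 3) K := fun i =>
    MvPolynomial.aeval ((E.baseChange K).toProjective.addPolynomial (coords Q)) (F i) with hH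
  have hHhom (i : Fin 3) : (H i).IsHomogeneous (2 * n) :=
    (hF.1 i).aeval _ (Projective.isHomogeneous_addPolynomial _ _)
  -- The addition formula gives the translated generic point up to a factor `c`, which homogeneity
  -- of `F` turns into `c ^ n`. Since `τ` fixes the coefficients of `F`, evaluating `F` at the
  -- translate of the generic point is applying `τ` to its generic value.
  have hHL : Represents (fun i => genVal E L (H i)) (Point.map τ Φ) := by
    obtain ⟨c, hc, h⟩ := represents_addPolynomial_baseChange (genericPoint_ne_baseChange Q)
      (represents_coords (genericPoint K E L))
    rw [← hτ] at h
    have h1 := ((hΦ n F hF (hF.genVal_ne_zero L hFQ)).map τ).smul (pow_ne_zero n hc)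
    convert h1 using 2 with i
    have h2 : (fun i => genVal E L ((E.baseChange K).toProjective.addPolynomial (coords Q) i)) =
        fun i => c * coords (Point.map τ (genericPoint K E L)) i := funext h
    rw [hH, genVal_aeval, h2, eval_smul_of_isHomogeneous ((hF.1 i).map _)]
    congr 1
    rw [genVal, MvPolynomial.aeval_def, MvPolynomial.eval_map, ← AlgHom.coe_toRingHom,
      MvPolynomial.hom_eval₂]
    congr 1
    · ext c
      exact (τ.commutes c).symm
    · ext i
      rw [coords_map]
      rfl
  have hHK : Represents (fun i =>
      MvPolynomial.eval (coords (0 : (E.baseChange K).toAffine.Point)) (H i)) (φ Q) := by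
    obtain ⟨c, hc, h⟩ := represents_addPolynomial (Ne.symm hQ)
      (represents_coords (0 : (E.baseChange K).toAffine.Point))
    rw [zero_add] at h
    have h1 := (hF.2 Q hFQ).smul (pow_ne_zero n hc)
    convert h1 using 2 with i
    rw [hH, MvPolynomial.eval_aeval_eq_eval, ← eval_smul_of_isHomogeneous (hF.1 i)]
    congr 2
    exact funext h
  obtain ⟨m, G, hG, hGL, hGK⟩ : ∃ (m : ℕ) (G : Fin 3 → MvPolynomial (Fin 3) K),
      (∀ i, (G i).IsHomogeneous m) ∧ Represents (fun i => genVal E L (G i)) (Point.map τ Φ) ∧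
      Represents (fun i => MvPolynomial.eval (coords (0 : (E.baseChange K).toAffine.Point)) (G i))
        R := by
    obtain ⟨m, G, hG, hG0⟩ := hφ 0
    have hGL := hΦ m G hG (hG.genVal_ne_zero L hG0)
    have hGK := hG.2 0 hG0
    rw [h0] at hGK
    by_cases hR0 : R = 0
    · subst hR0
      refine ⟨m, G, hG.1, ?_, hGK⟩
      rwa [hR, _root_.map_zero, add_zero]
    · refine ⟨m * 2, fun i => MvPolynomial.aeval G
        ((E'.baseChange K).toProjective.addPolynomial (coords R) i), fun i =>
        (Projective.isHomogeneous_addPolynomial _ _ i).aeval _ hG.1, ?_, ?_⟩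
      · rw [hR]
        convert represents_addPolynomial_baseChange (hne R) hGL using 2 with i
        rw [genVal_aeval, MvPolynomial.eval_map]
        rfl
      · have h := represents_addPolynomial (Ne.symm hR0) hGK
        rw [zero_add] at h
        simpa only [MvPolynomial.eval_aeval_eq_eval] using h
  refine eq_of_cross_eq hHK hGK fun i j => ?_
  have h1 : genVal E L (H i * G j - H j * G i) = 0 := by
    rw [map_sub, map_mul, map_mul, hHL.cross_eq hGL i j, sub_self]
  have h2 := eval_coords_eq_zero (((hHhom i).mul (hG j)).sub ((hHhom j).mul (hG i))) h1 0
  rwa [map_sub, map_mul, map_mul, sub_eq_zero] at h2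

/-- A nonconstant morphism of elliptic curves that preserves the identity is additive. -/
theorem IsMorphism.map_add [E'.IsElliptic]
    {φ : (E.baseChange K).toAffine.Point → (E'.baseChange K).toAffine.Point} (hφ : IsMorphism φ)
    (h0 : φ 0 = 0)
    {Φ : (E'.baseChange L).toAffine.Point} (hΦ : IsGenericValue L φ Φ)
    (hne : ∀ R, Φ ≠ Point.baseChange K L R) (P Q : (E.baseChange K).toAffine.Point) :
    φ (P + Q) = φ P + φ Q := by
  obtain ⟨τ, hτ⟩ := exists_translation L P
  obtain ⟨σ, hσ⟩ := exists_translation L Q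
  obtain ⟨R, hR⟩ := hΦ.exists_map_translation hφ hτ
  obtain ⟨S, hS⟩ := hΦ.exists_map_translation hφ hσ
  -- Both maps fix constant points, so `σ ∘ τ` is translation by `P + Q` and moves `Φ` by `R + S`.
  have h1 : Point.map (σ.comp τ) (genericPoint K E L) =
      genericPoint K E L + Point.baseChange K L (P + Q) := by
    rw [← Point.map_map, hτ, _root_.map_add, hσ, _root_.map_add, Point.map_baseChange]
    abel
  have h2 : Point.map (σ.comp τ) Φ = Φ + Point.baseChange K L (R + S) := by
    rw [← Point.map_map, hR, _root_.map_add, hS, _root_.map_add, Point.map_baseChange]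
    abel
  rw [hΦ.eq_of_map_translation hφ h0 hne hτ hR, hΦ.eq_of_map_translation hφ h0 hne hσ hS,
    hΦ.eq_of_map_translation hφ h0 hne h1 h2]

end Additive

end WeierstrassCurve

/-! ### Surjectivity of nonconstant morphisms -/

namespace WeierstrassCurve

open WeierstrassCurve.Affine Affine.Point Affine.FunctionField Affine.CoordinateRing

section Surjective

variable {k K : Type*} [Field k] [Field K] [Algebra k K] {E E' : WeierstrassCurve k}
  {L : Type*} [Field L] [Algebra K L] [Algebra (E.baseChange K).toAffine.CoordinateRing L]
  [IsScalarTower K (E.baseChange K).toAffine.CoordinateRing L]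
  [IsFractionRing (E.baseChange K).toAffine.CoordinateRing L]
  [Algebra k L] [IsScalarTower k K L] [IsAlgClosed K]

omit [Algebra k L] [IsScalarTower k K L] in
/-- A function that is regular at all points is constant. -/
lemma exists_eq_algebraMap_of_regular [E.IsElliptic] {h : L}
    (hreg : ∀ P : (E.baseChange K).toAffine.Point, ∃ (n : ℕ) (A B : MvPolynomial (Fin 3) K),
      A.IsHomogeneous n ∧ B.IsHomogeneous n ∧ MvPolynomial.eval (coords P) B ≠ 0 ∧
        h * genVal E L B = genVal E L A) : ∃ c : K, h = algebraMap K L c := by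
  simp only [← algebraMap_gen_eq_genVal] at hreg
  obtain ⟨c, hc⟩ := CoordinateRing.eq_algebraMap_of_regular (W := (E.baseChange K).toAffine)
    (L := L) (h := h) (fun a b hab => by
      obtain ⟨n, A, B, -, -, h⟩ := hreg (Point.mk hab)
      exact ⟨A, B, h⟩) (hreg 0)
  exact ⟨c, by rwa [← IsScalarTower.algebraMap_apply] at hc⟩

omit [IsScalarTower K (E.baseChange K).toAffine.CoordinateRing L]
  [IsFractionRing (E.baseChange K).toAffine.CoordinateRing L] [Algebra k L] [IsScalarTower k K L]
  [IsAlgClosed K] in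
lemma genVal_C (c : K) : genVal E L (MvPolynomial.C c : MvPolynomial (Fin 3) K) =
    algebraMap K L c := by
  simp [genVal]

omit [IsScalarTower K (E.baseChange K).toAffine.CoordinateRing L]
  [IsFractionRing (E.baseChange K).toAffine.CoordinateRing L] [Algebra k L] [IsScalarTower k K L]
  [IsAlgClosed K] in
/-- The function `(x - a)⁻¹` is regular where `x` has a pole. -/
lemma exists_inv_sub_mul_genVal_eq {a₁ a₂ a₃ a₄ a₆ a : K} {x y c : L}
    (hxa : x - algebraMap K L a ≠ 0)
    (e : y ^ 2 + algebraMap K L a₁ * x * y + algebraMap K L a₃ * y =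
      x ^ 3 + algebraMap K L a₂ * x ^ 2 + algebraMap K L a₄ * x + algebraMap K L a₆) {n : ℕ}
    {F : Fin 3 → MvPolynomial (Fin 3) K} (hF : ∀ i, (F i).IsHomogeneous n)
    (hv0 : genVal E L (F 0) = c * x) (hv1 : genVal E L (F 1) = c * y) (hv2 : genVal E L (F 2) = c)
    {v : Fin 3 → K} (hw0 : MvPolynomial.eval v (F 0) = 0) (hw1 : MvPolynomial.eval v (F 1) ≠ 0)
    (hw2 : MvPolynomial.eval v (F 2) = 0) : ∃ (n : ℕ) (A B : MvPolynomial (Fin 3) K),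
      A.IsHomogeneous n ∧ B.IsHomogeneous n ∧ MvPolynomial.eval v B ≠ 0 ∧
        (x - algebraMap K L a)⁻¹ * genVal E L B = genVal E L A := by
  -- With `t = x - a`, the Taylor expansion at `a` turns the curve equation into `y² + a₁xy + a₃y -
  -- f(a) = t(t² + (3a + a₂)t + 3a² + 2a₂a + a₄)`, where `f` is the cubic on the right. The
  -- homogenized left side is the denominator; it is nonzero at `[0 : 1 : 0]`.
  obtain ⟨G, hG⟩ : ∃ G, G = F 0 - MvPolynomial.C a * F 2 := ⟨_, rfl⟩
  have hGn : G.IsHomogeneous n := hG ▸ (hF 0).sub ((hF 2).C_mul a)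
  refine ⟨n + n, G * G + MvPolynomial.C (3 * a + a₂) * (G * F 2) +
      MvPolynomial.C (3 * a ^ 2 + 2 * a₂ * a + a₄) * (F 2 * F 2),
    F 1 * F 1 + MvPolynomial.C a₁ * (F 0 * F 1) + MvPolynomial.C a₃ * (F 1 * F 2) -
      MvPolynomial.C (a ^ 3 + a₂ * a ^ 2 + a₄ * a + a₆) * (F 2 * F 2),
    ((hGn.mul hGn).add ((hGn.mul (hF 2)).C_mul _)).add (((hF 2).mul (hF 2)).C_mul _),
    ((((hF 1).mul (hF 1)).add (((hF 0).mul (hF 1)).C_mul _)).add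
      (((hF 1).mul (hF 2)).C_mul _)).sub (((hF 2).mul (hF 2)).C_mul _), ?_, ?_⟩
  · simp only [map_add, map_sub, map_mul, hw0, hw2]
    simpa using hw1
  · simp only [hG, map_add, map_sub, map_mul, genVal_C, hv0, hv1, hv2, map_pow, map_ofNat]
    rw [inv_mul_eq_iff_eq_mul₀ hxa]
    linear_combination c ^ 2 * e

variable [E'.IsElliptic] [E.IsElliptic] [DecidableEq K] [DecidableEq L]

omit [E'.IsElliptic] in
/-- A nonconstant morphism `φ` whose image is stable under negation is surjective. -/
theorem IsGenericValue.surjective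
    {φ : (E.baseChange K).toAffine.Point → (E'.baseChange K).toAffine.Point} (hφ : IsMorphism φ)
    (h0 : φ 0 = 0) (hneg : ∀ P, φ (-P) = -φ P)
    {Φ : (E'.baseChange L).toAffine.Point} (hΦ : IsGenericValue L φ Φ)
    (hne : ∀ R, Φ ≠ Point.baseChange K L R) : Function.Surjective φ := by
  intro S
  by_contra! hS
  -- The first coordinate takes the value `a` only at `S` and `-S`, so both have to be missed for `x
  -- - a` to have no zero.
  have hS' (P) : φ P ≠ -S := fun h => hS (-P) (by rw [hneg, h, neg_neg])
  rcases S with _ | ⟨a, b, hab⟩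
  · exact hS 0 h0
  rcases Φ with _ | ⟨x, y, hxy⟩
  · exact hne 0 (_root_.map_zero _).symm
  have hx : Transcendental K x := fun hx => by
    obtain ⟨R, hR⟩ := exists_baseChange_eq_of_isAlgebraic hxy hx
    exact hne R hR.symm
  have hxa : x - algebraMap K L a ≠ 0 := fun h => hx (sub_eq_zero.1 h ▸ isAlgebraic_algebraMap a)
  suffices h : ∃ c : K, (x - algebraMap K L a)⁻¹ = algebraMap K L c by
    obtain ⟨c, hc⟩ := h
    refine hx ?_
    have : x = algebraMap K L (a + c⁻¹) := by
      rw [map_add, map_inv₀, ← hc, inv_inv]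
      ring
    exact this ▸ isAlgebraic_algebraMap _
  refine exists_eq_algebraMap_of_regular (E := E) fun P => ?_
  obtain ⟨n, F, hF, hFP⟩ := hφ P
  obtain ⟨c, hc, hv⟩ := hΦ n F hF (hF.genVal_ne_zero L hFP)
  have hv0 : genVal E L (F 0) = c * x := hv 0
  have hv1 : genVal E L (F 1) = c * y := hv 1
  have hv2 : genVal E L (F 2) = c := (hv 2).trans (mul_one c)
  obtain ⟨d, hd, hw⟩ := hF.2 P hFP
  have hSP := hS P
  have hSP' := hS' P
  generalize φ P = T at hw hSP hSP'
  rcases T with _ | ⟨x', y', hxy'⟩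
  · have hw0 : MvPolynomial.eval (coords P) (F 0) = 0 := (hw 0).trans (mul_zero d)
    have hw1 : MvPolynomial.eval (coords P) (F 1) = d := (hw 1).trans (mul_one d)
    have hw2 : MvPolynomial.eval (coords P) (F 2) = 0 := (hw 2).trans (mul_zero d)
    have e := (Affine.equation_iff _ _).1 hxy.1
    have hk (c : k) : algebraMap k L c = algebraMap K L (algebraMap k K c) :=
      IsScalarTower.algebraMap_apply k K L c
    simp only [WeierstrassCurve.baseChange, WeierstrassCurve.map, hk] at e
    exact exists_inv_sub_mul_genVal_eq hxa e hF.1 hv0 hv1 hv2 hw0 (hw1 ▸ hd) hw2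
  · have hw0 : MvPolynomial.eval (coords P) (F 0) = d * x' := hw 0
    have hw2 : MvPolynomial.eval (coords P) (F 2) = d := (hw 2).trans (mul_one d)
    refine ⟨n, F 2, F 0 - MvPolynomial.C a * F 2, hF.1 2,
      (hF.1 0).sub ((hF.1 2).C_mul a), ?_, ?_⟩
    · rw [map_sub, map_mul, hw0, hw2, MvPolynomial.eval_C]
      intro h
      have hx' : x' = a := by
        refine mul_left_cancel₀ hd ?_
        linear_combination h
      subst hx'
      rcases Affine.Y_eq_of_X_eq hxy'.1 hab.1 rfl with h | h
      · subst h
        exact hSP rfl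
      · refine hSP' ?_
        rw [Point.neg_some]
        subst h
        rfl
    · rw [map_sub, map_mul, genVal_C, hv0, hv2]
      field_simp

end Surjective

end WeierstrassCurve

/-! ### Isogenies -/

namespace WeierstrassCurve

open WeierstrassCurve.Affine Affine.Point

section Isogeny

variable {k K : Type*} [Field k] [Field K] [Algebra k K] {E E' : WeierstrassCurve k}
  [CharZero K] [IsAlgClosed K] [E.IsElliptic] [E'.IsElliptic] [DecidableEq K]

/-- A nonconstant morphism of elliptic curves that preserves the identity is a surjective
homomorphism. -/
theorem IsMorphism.map_add_and_surjective
    {φ : (E.baseChange K).toAffine.Point → (E'.baseChange K).toAffine.Point} (hφ : IsMorphism φ)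
    (h0 : φ 0 = 0) (hne : ∃ P Q, φ P ≠ φ Q) :
    (∀ P Q, φ (P + Q) = φ P + φ Q) ∧ Function.Surjective φ := by
  classical
  let L := FractionRing (E.baseChange K).toAffine.CoordinateRing
  obtain ⟨Φ, hΦ⟩ := exists_isGenericValue (L := L) hφ
  have hΦne (R) : Φ ≠ Point.baseChange K L R := by
    rintro rfl
    obtain ⟨P, Q, h⟩ := hne
    exact h ((hΦ.eq_of_constant hφ P).trans (hΦ.eq_of_constant hφ Q).symm)
  have hadd := hφ.map_add h0 hΦ hΦne
  refine ⟨hadd, hΦ.surjective hφ h0 (fun P => ?_) hΦne⟩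
  rw [eq_neg_iff_add_eq_zero, ← hadd, neg_add_cancel, h0]

end Isogeny

section Rational

local notation "ℚbar" => AlgebraicClosure ℚ

variable {E E' : WeierstrassCurve ℚ}

lemma homCoords_eq_coords (P : E.GeomPoint) : E.homCoords P = coords P := by
  rcases P with _ | ⟨x, y, h⟩ <;> rfl

lemma IsRationalMorphism.isMorphism {φ : E.GeomPoint → E'.GeomPoint} (hφ : IsRationalMorphism φ) :
    IsMorphism φ := by
  intro P
  obtain ⟨n, F, hF, hP, h⟩ := hφ P
  have he (Q : E.GeomPoint) (i : Fin 3) :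
      MvPolynomial.eval (coords Q) (MvPolynomial.map (algebraMap ℚ ℚbar) (F i)) =
        MvPolynomial.aeval (E.homCoords Q) (F i) := by
    rw [homCoords_eq_coords, MvPolynomial.eval_map, MvPolynomial.aeval_def]
  refine ⟨n, fun i => MvPolynomial.map (algebraMap ℚ ℚbar) (F i),
    ⟨fun i => (hF i).map _, fun Q hQ => ?_⟩, ?_⟩
  · simp only [he] at hQ ⊢
    simpa only [Represents, homCoords_eq_coords] using h Q hQ
  · simpa only [he] using hP

/-- The polynomials have rational coefficients, so their values at the conjugate of `P` are the
conjugates of their values at `P`; the same vector represents both sides. -/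
lemma IsRationalMorphism.map_galoisMap {φ : E.GeomPoint → E'.GeomPoint}
    (hφ : IsRationalMorphism φ) (σ : ℚbar ≃ₐ[ℚ] ℚbar) (P : E.GeomPoint) :
    φ (E.galoisMap σ P) = E'.galoisMap σ (φ P) := by
  obtain ⟨n, F, hF, hP, h⟩ := hφ P
  have hσ (i : Fin 3) : MvPolynomial.aeval (E.homCoords (E.galoisMap σ P)) (F i) =
      σ (MvPolynomial.aeval (E.homCoords P) (F i)) := by
    have hc : E.homCoords (E.galoisMap σ P) = fun i => σ (E.homCoords P i) := by
      rw [homCoords_eq_coords, homCoords_eq_coords]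
      exact funext fun i => coords_map σ.toAlgHom P i
    rw [hc]
    exact (MvPolynomial.comp_aeval_apply _ (σ : ℚbar →ₐ[ℚ] ℚbar) (F i)).symm
  have h1 : Represents (fun i => MvPolynomial.aeval (E.homCoords P) (F i)) (φ P) := by
    simpa only [Represents, homCoords_eq_coords] using h P hP
  have h2 : Represents (fun i => MvPolynomial.aeval (E.homCoords (E.galoisMap σ P)) (F i))
      (φ (E.galoisMap σ P)) := by
    simpa only [Represents, homCoords_eq_coords] using h (E.galoisMap σ P) (by
      simpa only [hσ, ne_eq, EmbeddingLike.map_eq_zero_iff] using hP)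
  simp only [hσ] at h2
  exact h2.unique (h1.map σ.toAlgHom)

end Rational

end WeierstrassCurve

/-! ### Homomorphisms of Tate modules -/

namespace TateModule

variable {A B : Type*} [AddCommGroup A] [AddCommGroup B] {p : ℕ}

/-- An element of the kernel of `f` that is killed by a power of `p` is zero. -/
lemma eq_zero_of_pow_smul_eq_zero {f : A →+ B} (hp : (Nat.card f.ker).Coprime p) {x : A}
    (hx : f x = 0) {n : ℕ} (hn : p ^ n • x = 0) : x = 0 := by
  have h : Nat.card f.ker • x = 0 := congrArg Subtype.val
    (card_nsmul_eq_zero' : Nat.card f.ker • (⟨x, hx⟩ : f.ker) = 0)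
  rw [← addOrderOf_dvd_iff_nsmul_eq_zero] at h hn
  rw [← AddMonoid.addOrderOf_eq_one_iff]
  exact Nat.eq_one_of_dvd_coprimes (hp.pow_right n) h hn

/-- A surjective homomorphism whose kernel has order prime to `p` induces an isomorphism of Tate
modules. -/
theorem map_bijective [Fact p.Prime] {f : A →+ B} (hf : Function.Surjective f)
    (hp : (Nat.card f.ker).Coprime p) : Function.Bijective (map (p := p) f) := by
  constructor
  · rw [injective_iff_map_eq_zero]
    intro x hx
    ext n
    exact eq_zero_of_pow_smul_eq_zero hp (congrFun (congrArg Subtype.val hx) n)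
      (pow_smul_apply x n)
  · intro y
    -- Any preimage `u` is corrected to `e • u` with `e ≡ 1` modulo `p ^ n` and `e ≡ 0` modulo the
    -- order of the kernel. This keeps the image and kills `p ^ n • u`, which lies in the kernel.
    have hex (n : ℕ) : ∃ x, f x = y.1 n ∧ p ^ n • x = 0 := by
      obtain ⟨u, hu⟩ := hf (y.1 n)
      obtain ⟨e, he1, he0⟩ := Nat.chineseRemainder (hp.symm.pow_left n) 1 0
      refine ⟨e • u, ?_, ?_⟩
      · rw [map_nsmul, hu]
        conv_rhs => rw [← one_smul ℕ (y.1 n)]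
        exact smul_congr y n ((ZMod.natCast_eq_natCast_iff _ _ _).2 he1)
      · have hm : f (p ^ n • u) = 0 := by rw [map_nsmul, hu, pow_smul_apply]
        have h : Nat.card f.ker • (p ^ n • u) = 0 := congrArg Subtype.val
          (card_nsmul_eq_zero' : Nat.card f.ker • (⟨p ^ n • u, hm⟩ : f.ker) = 0)
        obtain ⟨t, rfl⟩ := (Nat.modEq_zero_iff_dvd).1 he0
        rw [smul_comm, mul_comm, mul_smul, h, smul_zero]
    choose x hx hxp using hex
    refine ⟨⟨x, ?_, fun n => ?_⟩, ?_⟩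
    · simpa using hxp 0
    -- The lifts are automatically compatible: `p • x (n + 1) - x n` lies in the kernel and is
    -- killed by `p ^ n`.
    · rw [← sub_eq_zero]
      refine eq_zero_of_pow_smul_eq_zero hp (n := n) ?_ ?_
      · rw [map_sub, map_nsmul, hx, hx, y.2.2, sub_self]
      · rw [smul_sub, ← mul_smul, ← pow_succ, hxp, hxp, sub_self]
    · ext n
      exact hx n

end TateModule

/-! ### Conjugacy of the Galois images -/

namespace WeierstrassCurve

variable {E E' : WeierstrassCurve ℚ} {ℓ : ℕ} [Fact ℓ.Prime]

/-- The isomorphism intertwines the representations for each `σ` separately, which is stronger than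
conjugacy of the images. -/
lemma adicImage_eq_map_of_galoisMap (φ : E.GeomPoint →+ E'.GeomPoint)
    (hφ : ∀ σ P, φ (E.galoisMap σ P) = E'.galoisMap σ (φ P))
    (f : E.tateModule ℓ ≃ₗ[ℤ_[ℓ]] E'.tateModule ℓ) (hf : ∀ x, f x = TateModule.map φ x) :
    E'.adicImage ℓ = (E.adicImage ℓ).map
      (LinearMap.GeneralLinearGroup.congrLinearEquiv f : _ →* _) := by
  rw [adicImage, adicImage, MonoidHom.map_range]
  congr 1
  ext σ : 1
  ext y : 2
  obtain ⟨x, rfl⟩ := f.surjective y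
  have h : (E'.galoisRep ℓ σ).1 (f x) = f ((E.galoisRep ℓ σ).1 x) := by
    rw [hf, hf]
    ext n
    exact (hφ σ (x.1 n)).symm
  refine h.trans ?_
  simp

lemma adicImageMatrix_eq_map_conj (f : E.tateModule ℓ ≃ₗ[ℤ_[ℓ]] E'.tateModule ℓ)
    (hf : E'.adicImage ℓ = (E.adicImage ℓ).map
      (LinearMap.GeneralLinearGroup.congrLinearEquiv f : _ →* _))
    (b : Module.Basis (Fin 2) ℤ_[ℓ] (E.tateModule ℓ))
    (b' : Module.Basis (Fin 2) ℤ_[ℓ] (E'.tateModule ℓ)) :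
    ∃ g : GL (Fin 2) ℤ_[ℓ],
      adicImageMatrix b' = (adicImageMatrix b).map (MulAut.conj g : _ →* _) := by
  -- The conjugating matrix is that of `f` in the two given bases.
  refine ⟨⟨LinearMap.toMatrix b b' f, LinearMap.toMatrix b' b f.symm, ?_, ?_⟩, ?_⟩
  · rw [← LinearMap.toMatrix_comp]
    simp
  · rw [← LinearMap.toMatrix_comp]
    simp
  · rw [adicImageMatrix, adicImageMatrix, hf, Subgroup.map_map, Subgroup.map_map]
    congr 1
    ext u : 2
    change LinearMap.toMatrix b' b' ((f : E.tateModule ℓ →ₗ[ℤ_[ℓ]] E'.tateModule ℓ) ∘ₗ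
      (u : E.tateModule ℓ →ₗ[ℤ_[ℓ]] E.tateModule ℓ) ∘ₗ f.symm) =
      LinearMap.toMatrix b b' f * LinearMap.toMatrix b b u * LinearMap.toMatrix b' b f.symm
    rw [LinearMap.toMatrix_comp b' b b', LinearMap.toMatrix_comp b' b b, mul_assoc]

end WeierstrassCurve

/-- Let `E`, `E'` be elliptic curves over `ℚ` and `φ : E → E'` an isogeny defined over `ℚ` whose
kernel is finite and cyclic of order not divisible by the prime `ℓ`. Then the images of the
`ℓ`-adic Galois representations of `E` and `E'` are conjugate: intrinsically, through an isomorphism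
of the Tate modules, and as subgroups of `GL(2, ℤ_ℓ)`, for every choice of bases. -/
theorem mainTheorem7 (E E' : WeierstrassCurve ℚ) [E.IsElliptic] [E'.IsElliptic]
    (ℓ : ℕ) [Fact ℓ.Prime] (φ : E.GeomPoint → E'.GeomPoint)
    (hφ : WeierstrassCurve.IsRationalIsogeny φ)
    (hfin : (WeierstrassCurve.isogenyKer φ).Finite)
    (hcyc : ∃ P : E.GeomPoint,
      WeierstrassCurve.isogenyKer φ = (AddSubgroup.zmultiples P : Set E.GeomPoint))
    (hdeg : ¬ ℓ ∣ (WeierstrassCurve.isogenyKer φ).ncard) :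
    (∃ f : E.tateModule ℓ ≃ₗ[ℤ_[ℓ]] E'.tateModule ℓ,
      E'.adicImage ℓ = (E.adicImage ℓ).map
        (LinearMap.GeneralLinearGroup.congrLinearEquiv f : _ →* _)) ∧
    ∀ (b : Module.Basis (Fin 2) ℤ_[ℓ] (E.tateModule ℓ))
      (b' : Module.Basis (Fin 2) ℤ_[ℓ] (E'.tateModule ℓ)),
      ∃ g : GL (Fin 2) ℤ_[ℓ],
        WeierstrassCurve.adicImageMatrix b' =
          (WeierstrassCurve.adicImageMatrix b).map (MulAut.conj g : _ →* _) := by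
  obtain ⟨hadd, hsurj⟩ := hφ.isRationalMorphism.isMorphism.map_add_and_surjective hφ.map_zero
    hφ.nonconstant
  let ψ : E.GeomPoint →+ E'.GeomPoint := ⟨⟨φ, hφ.map_zero⟩, hadd⟩
  have hcop : (Nat.card ψ.ker).Coprime ℓ := by
    rw [Nat.coprime_comm, (Fact.out : ℓ.Prime).coprime_iff_not_dvd]
    exact hdeg
  have hbij := TateModule.map_bijective (f := ψ) hsurj hcop
  have hf := WeierstrassCurve.adicImage_eq_map_of_galoisMap ψ
    hφ.isRationalMorphism.map_galoisMap (LinearEquiv.ofBijective (TateModule.map ψ) hbij)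
    fun _ => rfl
  exact ⟨⟨_, hf⟩, WeierstrassCurve.adicImageMatrix_eq_map_conj _ hf⟩
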